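/- A deterministic one-tape Turing machine (DTM) $M=\langle Q,\Sigma,\Gamma,\delta,q_0,F\rangle$ has a finite state set $Q$, an input alphabet $\Sigma$, a finite working alphabet $\Gamma\supseteq\Sigma$ containing a blank symbol $b\in\Gamma\setminus\Sigma$, an initial state $q_0\in Q$, a set $F\subseteq Q$ of final states, and a partial transition function $\delta:Q\times\Gamma\to Q\times(\Gamma\setminus\{b\})\times\{-1,+1\}$ (new state, written symbol, head move). It works on a bi-infinite tape that initially contains the input word $w\in\Sigma^*$ and blanks elsewhere, with the head on the leftmost symbol of $w$ (on some blank cell if $w$ is empty). It halts when no transition applies, and it accepts $w$ if it eventually halts in a final state. Two DTMs over the same input alphabet are equivalent if they accept the same language. A DTM is weight-reducing if there is a partial order $<$ on $\Gamma$ such that $\delta(p,\sigma)=(q,\tau,d)$ implies $\tau<\sigma$. It is linear-time if there are constants $K,C$ such that on every input $w$ it halts within $K|w|+C$ steps. The size of a DTM is the length of a binary description of it (the numbers of states, working symbols and input symbols, the lists of input symbols and final states, the blank, the initial state, and the full transition table, with states and symbols numbered in binary); it is of order $|Q|\cdot|\Gamma|\cdot\log(|Q|\cdot|\Gamma|)$.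 **Proposition.** There is a polynomial $P$ such that for every weight-reducing DTM $M$ there is an equivalent weight-reducing DTM $M'$ that is linear-time (in particular, it halts on every input) and whose size is at most $P(\mathrm{size}(M))$. -/

import Mathlib

universe u

/-- A deterministic one-tape Turing machine with input alphabet `A`. The input alphabet is
embedded in the working alphabet `Symbol`, the blank is a working symbol outside the input
alphabet, and it is never written. The transition function is partial (`none` = undefined), and in
each step the head moves one cell to the left or to the right. -/
structure DTM (A : Type u) where
  /-- states -/
  State : Type u
  /-- working symbols -/
  Symbol : Type u
  [finiteState : Finite State]
  [finiteSymbol : Finite Symbol]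
  /-- the inclusion of the input alphabet in the working alphabet -/
  input : A ↪ Symbol
  /-- the blank symbol -/
  blank : Symbol
  blank_not_input : ∀ a, input a ≠ blank
  /-- the partial transition function -/
  δ : State → Symbol → Option (State × Symbol × Turing.Dir)
  blank_not_written : ∀ p σ q τ d, δ p σ = some (q, τ, d) → τ ≠ blank
  /-- the initial state -/
  start : State
  /-- the final states -/
  final : Set State

namespace DTM

attribute [instance] DTM.finiteState DTM.finiteSymbol

variable {A : Type u}

/-- A configuration: the current state, the contents of the bi-infinite tape, and the position of
the head. -/
structure Cfg (M : DTM A) where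
  state : M.State
  tape : ℤ → M.Symbol
  head : ℤ

/-- The displacement of the head. -/
def shift : Turing.Dir → ℤ
  | Turing.Dir.left => -1
  | Turing.Dir.right => 1

/-- The successor of a configuration; `none` if no transition applies, that is, if the
configuration is halting. -/
def step (M : DTM A) (c : M.Cfg) : Option M.Cfg :=
  (M.δ c.state (c.tape c.head)).map fun r =>
    { state := r.1
      tape := Function.update c.tape c.head r.2.1
      head := c.head + shift r.2.2 }

/-- The initial configuration on `w`: the input is written on the cells `0, …, |w| - 1`, all other
cells are blank, and the head scans the cell `0`. -/
def init (M : DTM A) (w : List A) : M.Cfg where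
  state := M.start
  tape := fun i => if 0 ≤ i then ((w[i.toNat]?).map M.input).getD M.blank else M.blank
  head := 0

/-- The configuration reached on input `w` after exactly `t` steps; `none` if the machine halts
before. -/
def run (M : DTM A) (w : List A) : ℕ → Option M.Cfg
  | 0 => some (M.init w)
  | t + 1 => (M.run w t).bind M.step

/-- On input `w` the machine halts after exactly `t` steps, in the configuration `c`. -/
def HaltsIn (M : DTM A) (w : List A) (t : ℕ) (c : M.Cfg) : Prop :=
  M.run w t = some c ∧ M.step c = none

/-- The language accepted by `M`: the words on which `M` eventually halts in a final state. -/
def language (M : DTM A) : Language A :=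
  {w | ∃ t c, M.HaltsIn w t c ∧ c.state ∈ M.final}

/-- Some partial order on the working alphabet makes every rewriting strictly decreasing. -/
def WeightReducing (M : DTM A) : Prop :=
  ∃ _ : PartialOrder M.Symbol, ∀ p σ q τ d, M.δ p σ = some (q, τ, d) → τ < σ

/-- Every computation halts, within a number of steps that is linear in the input length. -/
def LinearTime (M : DTM A) : Prop :=
  ∃ K C : ℕ, ∀ w : List A, ∃ t c, M.HaltsIn w t c ∧ t ≤ K * w.length + C

/-- The `width` lowest binary digits of `k`. -/
def binary (width k : ℕ) : List Bool :=
  (List.range width).map k.testBit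

/-- The unary notation of `k`, terminated by `false`. -/
def unary (k : ℕ) : List Bool :=
  List.replicate k true ++ [false]

/-- The number of a state, in binary with `⌈log₂ |Q|⌉` digits. -/
noncomputable def stateCode (M : DTM A) (q : M.State) : List Bool :=
  binary (Nat.clog 2 (Nat.card M.State)) (Finite.equivFin M.State q)

/-- The number of a working symbol, in binary with `⌈log₂ |Γ|⌉` digits. -/
noncomputable def symbolCode (M : DTM A) (σ : M.Symbol) : List Bool :=
  binary (Nat.clog 2 (Nat.card M.Symbol)) (Finite.equivFin M.Symbol σ)

/-- One entry of the transition table: a bit telling whether the transition is defined, then the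
new state, the written symbol and the move (for an undefined transition, padding). -/
noncomputable def entryCode (M : DTM A) (p : M.State) (σ : M.Symbol) : List Bool :=
  match M.δ p σ with
  | none => false :: (M.stateCode p ++ M.symbolCode σ ++ [false])
  | some (q, τ, d) => true :: (M.stateCode q ++ M.symbolCode τ ++ [decide (d = Turing.Dir.right)])

open Classical in
/-- A description of the machine as a binary word: the numbers of states, working symbols and
input symbols, the input symbols, the blank, the initial state, the set of final states, and the
table of the transition function. -/
noncomputable def description [Finite A] (M : DTM A) : List Bool :=
  let states := (List.finRange (Nat.card M.State)).map (Finite.equivFin M.State).symm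
  let symbols := (List.finRange (Nat.card M.Symbol)).map (Finite.equivFin M.Symbol).symm
  let letters := (List.finRange (Nat.card A)).map (Finite.equivFin A).symm
  unary (Nat.card M.State) ++ unary (Nat.card M.Symbol) ++ unary (Nat.card A) ++
    letters.flatMap (fun a => M.symbolCode (M.input a)) ++
    M.symbolCode M.blank ++ M.stateCode M.start ++
    states.map (fun q => decide (q ∈ M.final)) ++
    states.flatMap (fun p => symbols.flatMap (fun σ => M.entryCode p σ))

/-- The size of a machine: the number of symbols in its description. -/
noncomputable def size [Finite A] (M : DTM A) : ℕ :=
  M.description.length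

end DTM

namespace DTM

open Relation

variable {A : Type u}

/-! Each step lowers the rank of the scanned cell, so a cell is rewritten at most |Γ| times, and a
weight-reducing machine whose head stays within a constant distance of the input is linear-time
(`WeightReducing.linearTime`). The only danger is a head running off into the blanks. In a halting
computation this is limited: crossing sequences in the blank part have length at most |Γ|, so beyond
(|Q|+1)^|Γ| cells two boundaries share one. What happens right of a boundary depends only on its
crossing sequence (`Trace.tape_eq`), so the final tape would repeat forever, which is absurd
(`WeightReducing.head_le`). A head that gets farther may be stopped and the input rejected.

This distance is exponential, but the new machine must be of polynomial size, so the distance is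
measured on the tape. With n = |Q|·|Γ|, blocks of n + 1 binary digits count 0, 1, 2, …; each block
is copied, incremented, from the preceding one, digit by digit, and the last cell of the block of
ones becomes a fence. A cell is visited only O(n) times meanwhile, so a layer with 2n + 8 values,
lowered at each visit, keeps the set-up weight-reducing (`exists_simulates_of_fenceInit`). Then the
machine is simulated, and touching the fence rejects.

The mirrored construction, applied to the machine with a right fence, guards the left side. The
fence distances do not depend on the word, so they only affect the additive constant of the running
time. -/

@[simp] theorem shift_left : shift Turing.Dir.left = -1 := rfl

@[simp] theorem shift_right : shift Turing.Dir.right = 1 := rfl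

/-! ### Steps, reachability and acceptance. -/

theorem Cfg.ext {M : DTM A} {c d : M.Cfg} (h : c.state = d.state) (h' : ∀ x, c.tape x = d.tape x)
    (h'' : c.head = d.head) : c = d := by
  cases c; cases d; simp_all [funext_iff]

/-- The configuration `d` can be reached from `c` in any number of steps. -/
abbrev Reaches (M : DTM A) (c d : M.Cfg) : Prop :=
  StateTransition.Reaches M.step c d

/-- Started in `c` the machine eventually halts in a final state. -/
def AcceptsFrom (M : DTM A) (c : M.Cfg) : Prop :=
  ∃ d ∈ StateTransition.eval M.step c, d.state ∈ M.final

theorem step_eq_some {M : DTM A} {c d : M.Cfg} (h : M.step c = some d) :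
    ∃ q τ e, M.δ c.state (c.tape c.head) = some (q, τ, e) ∧
      d = ⟨q, Function.update c.tape c.head τ, c.head + shift e⟩ := by
  obtain ⟨⟨q, τ, e⟩, h1, h2⟩ := Option.map_eq_some_iff.1 h
  exact ⟨q, τ, e, h1, h2.symm⟩

theorem step_of_δ {M : DTM A} {c : M.Cfg} {q τ e}
    (h : M.δ c.state (c.tape c.head) = some (q, τ, e)) :
    M.step c = some ⟨q, Function.update c.tape c.head τ, c.head + shift e⟩ := by
  simp [step, h]

theorem step_eq_none {M : DTM A} {c : M.Cfg} :
    M.step c = none ↔ M.δ c.state (c.tape c.head) = none := by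
  simp [step]

theorem head_of_step {M : DTM A} {c d : M.Cfg} (h : M.step c = some d) :
    d.head = c.head + 1 ∨ d.head = c.head - 1 := by
  obtain ⟨q, τ, e, -, rfl⟩ := step_eq_some h
  cases e
  · right; simp; ring
  · left; simp

theorem tape_of_step {M : DTM A} {c d : M.Cfg} (h : M.step c = some d) {x : ℤ}
    (hx : x ≠ c.head) : d.tape x = c.tape x := by
  obtain ⟨q, τ, e, -, rfl⟩ := step_eq_some h
  simp [hx]

theorem tape_head_of_step {M : DTM A} {c d : M.Cfg} (h : M.step c = some d) :
    d.tape c.head ≠ M.blank := by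
  obtain ⟨q, τ, e, h', rfl⟩ := step_eq_some h
  simpa using M.blank_not_written _ _ _ _ _ h'

theorem reaches_iff_run {M : DTM A} {w : List A} {d : M.Cfg} :
    M.Reaches (M.init w) d ↔ ∃ t, M.run w t = some d := by
  constructor
  · intro h
    induction h with
    | refl => exact ⟨0, rfl⟩
    | tail _ h ih =>
      obtain ⟨t, ht⟩ := ih
      exact ⟨t + 1, by rw [run, ht]; exact h⟩
  · rintro ⟨t, ht⟩
    induction t generalizing d with
    | zero => cases ht; exact ReflTransGen.refl
    | succ t ih =>
      obtain ⟨c, hc, hd⟩ := Option.bind_eq_some_iff.1 ht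
      exact (ih hc).tail hd

theorem mem_language_iff {M : DTM A} {w : List A} :
    w ∈ M.language ↔ M.AcceptsFrom (M.init w) := by
  constructor
  · rintro ⟨t, c, ⟨h1, h2⟩, h3⟩
    exact ⟨c, StateTransition.mem_eval.2 ⟨reaches_iff_run.2 ⟨t, h1⟩, h2⟩, h3⟩
  · rintro ⟨c, h, h3⟩
    obtain ⟨h1, h2⟩ := StateTransition.mem_eval.1 h
    obtain ⟨t, ht⟩ := reaches_iff_run.1 h1
    exact ⟨t, c, ⟨ht, h2⟩, h3⟩

theorem acceptsFrom_congr {M : DTM A} {c d : M.Cfg} (h : M.Reaches c d) :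
    M.AcceptsFrom c ↔ M.AcceptsFrom d := by
  rw [AcceptsFrom, AcceptsFrom, StateTransition.reaches_eval h]

/-- The blank is never written, so the final tape remembers which cells have been rewritten. -/
theorem tape_ne_blank_of_reaches {M : DTM A} {c d : M.Cfg} (h : M.Reaches c d) {x : ℤ}
    (hx : c.tape x ≠ M.blank) : d.tape x ≠ M.blank := by
  induction h with
  | refl => exact hx
  | @tail b d _ h ih =>
    by_cases e : x = b.head
    · exact e ▸ tape_head_of_step h
    · rwa [tape_of_step h e]

theorem exists_tape_eq_of_reaches {M : DTM A} {c d : M.Cfg} (h : M.Reaches c d) :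
    ∃ B : ℤ, ∀ x ≥ B, d.tape x = c.tape x := by
  induction h with
  | refl => exact ⟨0, fun _ _ => rfl⟩
  | @tail b d _ h ih =>
    obtain ⟨B, hB⟩ := ih
    refine ⟨max B (b.head + 1), fun x hx => ?_⟩
    rw [tape_of_step h (by have := le_max_right B (b.head + 1); omega)]
    exact hB x (le_trans (le_max_left _ _) hx)

/-! ### Ranks -/

/-- Every rewriting strictly decreases `f`. -/
def IsRank (M : DTM A) (f : M.Symbol → ℕ) : Prop :=
  ∀ p σ q τ d, M.δ p σ = some (q, τ, d) → f τ < f σ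

theorem IsRank.weightReducing {M : DTM A} {f : M.Symbol → ℕ} (hf : M.IsRank f) :
    M.WeightReducing := by
  refine ⟨{ le := fun a b => a = b ∨ f a < f b
            lt := fun a b => f a < f b
            le_refl := fun _ => Or.inl rfl
            le_trans := ?_, lt_iff_le_not_ge := ?_, le_antisymm := ?_ }, hf⟩
  · rintro a b c (rfl | h) (rfl | h')
    exacts [Or.inl rfl, Or.inr h', Or.inr h, Or.inr (h.trans h')]
  · intro a b
    constructor
    · intro h
      refine ⟨Or.inr h, ?_⟩
      rintro (rfl | h')
      exacts [lt_irrefl _ h, lt_asymm h h']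
    · rintro ⟨rfl | h, h'⟩
      exacts [absurd (Or.inl rfl) h', h]
  · rintro a b (rfl | h) (h' | h')
    exacts [rfl, rfl, h'.symm, absurd h' (lt_asymm h)]

/-- The rank of a symbol is the number of symbols strictly below it. -/
theorem WeightReducing.exists_rank {M : DTM A} (h : M.WeightReducing) :
    ∃ f : M.Symbol → ℕ, M.IsRank f ∧ ∀ σ, f σ < Nat.card M.Symbol := by
  obtain ⟨_, h⟩ := h
  refine ⟨fun σ => (Set.Iio σ).ncard, fun p σ q τ d e => ?_, fun σ => ?_⟩
  · exact Set.ncard_lt_ncard (Set.Iio_ssubset_Iio (h p σ q τ d e))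
  · rw [← Set.ncard_univ]
    exact Set.ncard_lt_ncard ((Set.ssubset_univ_iff).2 fun e => by
      simpa using (e ▸ Set.mem_univ σ : σ ∈ Set.Iio σ))

theorem IsRank.step_lt {M : DTM A} {f : M.Symbol → ℕ} (hf : M.IsRank f) {c d : M.Cfg}
    (h : M.step c = some d) : f (d.tape c.head) < f (c.tape c.head) := by
  obtain ⟨q, τ, e, h', rfl⟩ := step_eq_some h
  simpa using hf _ _ _ _ _ h'

/-- A weight-reducing machine whose head stays near the input halts in linear time. -/
theorem WeightReducing.linearTime {M : DTM A} (hM : M.WeightReducing) (N : ℕ)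
    (hN : ∀ w d, M.Reaches (M.init w) d → -(N : ℤ) ≤ d.head ∧ d.head ≤ w.length + N) :
    M.LinearTime := by
  obtain ⟨f, hf, hb⟩ := hM.exists_rank
  set g := Nat.card M.Symbol
  refine ⟨g, g * (2 * N + 1), fun w => ?_⟩
  let S : Finset ℤ := Finset.Icc (-(N : ℤ)) (w.length + N)
  -- The total rank of a window that always contains the head is a potential: every step lowers it.
  let V : M.Cfg → ℕ := fun c => ∑ x ∈ S, f (c.tape x)
  have hS : S.card = w.length + 2 * N + 1 := by
    simp only [S, Int.card_Icc]; omega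
  have hV : V (M.init w) ≤ g * w.length + g * (2 * N + 1) := by
    have : V (M.init w) ≤ S.card • g := Finset.sum_le_card_nsmul _ _ _ fun x _ => (hb _).le
    rw [hS, smul_eq_mul] at this
    linarith
  have hstep : ∀ c d, M.Reaches (M.init w) c → M.step c = some d → V d < V c := by
    intro c d hc h
    have hmem : c.head ∈ S := Finset.mem_Icc.2 (hN w c hc)
    refine Finset.sum_lt_sum (fun x _ => ?_) ⟨c.head, hmem, hf.step_lt h⟩
    by_cases e : x = c.head
    · exact e ▸ (hf.step_lt h).le
    · rw [tape_of_step h e]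
  have key : ∀ t, (∃ s c, M.HaltsIn w s c ∧ s ≤ t) ∨
      ∃ c, M.run w t = some c ∧ V c + t ≤ V (M.init w) := by
    intro t
    induction t with
    | zero => exact Or.inr ⟨_, rfl, le_rfl⟩
    | succ t ih =>
      rcases ih with ⟨s, c, h, hs⟩ | ⟨c, h, hc⟩
      · exact Or.inl ⟨s, c, h, hs.trans t.le_succ⟩
      · cases e : M.step c with
        | none => exact Or.inl ⟨t, c, ⟨h, e⟩, t.le_succ⟩
        | some d =>
          have := hstep c d (reaches_iff_run.2 ⟨t, h⟩) e
          exact Or.inr ⟨d, by rw [run, h]; exact e, by omega⟩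
  rcases key (V (M.init w)) with ⟨s, c, h, hs⟩ | ⟨c, h, hc⟩
  · exact ⟨s, c, h, hs.trans hV⟩
  · refine ⟨_, c, ⟨h, ?_⟩, hV⟩
    cases e : M.step c with
    | none => rfl
    | some d =>
      have := hstep c d (reaches_iff_run.2 ⟨_, h⟩) e
      omega

/-! ### Crossing sequences -/

/-- `M.Trace i c l f`: started in `c` the machine halts in `f`, and `l` lists the states in which
the head enters the cells `≥ i` from the left. -/
inductive Trace (M : DTM A) (i : ℤ) : M.Cfg → List M.State → M.Cfg → Prop
  | halt {c : M.Cfg} : M.step c = none → Trace M i c [] c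
  | enter {c d f : M.Cfg} {l : List M.State} : M.step c = some d → c.head < i → i ≤ d.head →
      Trace M i d l f → Trace M i c (d.state :: l) f
  | stay {c d f : M.Cfg} {l : List M.State} : M.step c = some d → ¬ (c.head < i ∧ i ≤ d.head) →
      Trace M i d l f → Trace M i c l f

theorem exists_trace {M : DTM A} {c f : M.Cfg} (h : M.Reaches c f) (hf : M.step f = none) (i : ℤ) :
    ∃ l, M.Trace i c l f := by
  induction h using ReflTransGen.head_induction_on with
  | refl => exact ⟨[], .halt hf⟩
  | @head c d h _ ih =>
    obtain ⟨l, hl⟩ := ih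
    by_cases e : c.head < i ∧ i ≤ d.head
    · exact ⟨_, .enter h e.1 e.2 hl⟩
    · exact ⟨l, .stay h e hl⟩

/-- The head enters at the cell `i` and can leave to the left only by rewriting it, so between two
entries its rank drops. A head starting on the left has one entry for free. -/
theorem Trace.length_le {M : DTM A} {g : M.Symbol → ℕ} (hg : M.IsRank g) {i : ℤ} {c f : M.Cfg}
    {l : List M.State} (h : M.Trace i c l f) :
    l.length ≤ g (c.tape i) + if c.head < i then 1 else 0 := by
  induction h with
  | halt => simp
  | @enter c d f l hs h1 h2 _ ih =>
    rw [if_neg (by omega), tape_of_step hs (by omega)] at ih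
    rw [if_pos h1, List.length_cons]
    omega
  | @stay c d f l hs h1 _ ih =>
    refine ih.trans ?_
    have hh := head_of_step hs
    by_cases e : i = c.head
    · have := hg.step_lt hs
      rw [e]
      split_ifs <;> omega
    · rw [tape_of_step hs e]
      split_ifs <;> omega

theorem Trace.exists_enter {M : DTM A} {i : ℤ} {c f : M.Cfg} {q : M.State} {l : List M.State}
    (h : M.Trace i c (q :: l) f) (hc : c.head < i) :
    ∃ d, d.state = q ∧ d.head = i ∧ (∀ x ≥ i, d.tape x = c.tape x) ∧ M.Trace i d l f := by
  generalize e : q :: l = l' at h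
  induction h with
  | halt => cases e
  | @enter c d f l' hs h1 h2 ht _ =>
    cases e
    have hh := head_of_step hs
    exact ⟨d, rfl, by omega, fun x hx => tape_of_step hs (by omega), ht⟩
  | @stay c d f l' hs h1 _ ih =>
    obtain ⟨d', h2, h3, h4, h5⟩ := ih (by by_contra; exact h1 ⟨hc, by omega⟩) e
    exact ⟨d', h2, h3, fun x hx => by rw [h4 x hx, tape_of_step hs (by omega)], h5⟩

theorem Trace.tape_eq_of_nil {M : DTM A} {i : ℤ} {c f : M.Cfg}
    (h : M.Trace i c [] f) (hc : c.head < i) {x : ℤ} (hx : i ≤ x) : f.tape x = c.tape x := by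
  generalize e : [] = l' at h
  induction h with
  | halt => rfl
  | enter => cases e
  | @stay c d f l' hs h1 _ ih =>
    rw [ih (by by_contra; exact h1 ⟨hc, by omega⟩) e, tape_of_step hs (by omega)]

/-- What a halting computation leaves to the right of a boundary depends only on the initial
contents there and on the crossing sequence. -/
theorem Trace.tape_eq {M : DTM A} {i k : ℤ} {c c' f f' : M.Cfg} {l : List M.State}
    (h : M.Trace i c l f) (h' : M.Trace (i + k) c' l f')
    (htape : ∀ x ≥ i, c'.tape (x + k) = c.tape x)
    (hside : (c.head < i ∧ c'.head < i + k) ∨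
      (i ≤ c.head ∧ c'.head = c.head + k ∧ c'.state = c.state)) :
    ∀ x ≥ i, f'.tape (x + k) = f.tape x := by
  have both : ∀ {c d c' : M.Cfg}, M.step c = some d → i ≤ c.head → c'.head = c.head + k →
      c'.state = c.state → (∀ x ≥ i, c'.tape (x + k) = c.tape x) →
      ∃ d', M.step c' = some d' ∧ d'.head = d.head + k ∧ d'.state = d.state ∧
        ∀ x ≥ i, d'.tape (x + k) = d.tape x := by
    intro c d c' hs h1 h2 h3 ht
    obtain ⟨q, τ, e, hδ, rfl⟩ := step_eq_some hs
    refine ⟨_, step_of_δ (q := q) (τ := τ) (e := e) ?_, ?_, rfl, fun x hx => ?_⟩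
    · rw [h2, h3, ht _ h1, hδ]
    · simp only [h2]; ring
    · simp only [h2, Function.update_apply, add_left_inj, ht x hx]
  induction h generalizing c' with
  | @halt c hs =>
    intro x hx
    rcases hside with ⟨h1, h2⟩ | ⟨h1, h2, h3⟩
    · rw [h'.tape_eq_of_nil h2 (by omega), htape x hx]
    · cases h' with
      | halt => exact htape x hx
      | stay hs' =>
        rw [step_eq_none] at hs
        obtain ⟨_, _, _, h, _⟩ := step_eq_some hs'
        rw [h2, h3, htape _ h1, hs] at h
        cases h
  | @enter c d f l hs h1 h2 _ ih =>
    obtain ⟨-, h3⟩ := hside.resolve_right (by omega)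
    -- On the left the second run is arbitrary. It is forwarded to its own next entry, where
    -- equality of the crossing sequences puts it in the same state as the first.
    obtain ⟨d', e1, e2, e3, e4⟩ := h'.exists_enter h3
    have hh := head_of_step hs
    refine ih e4 (fun x hx => ?_) (Or.inr ⟨h2, by omega, e1⟩)
    rw [e3 _ (by omega), htape x hx, tape_of_step hs (by omega)]
  | @stay c d f l hs h1 _ ih =>
    rcases hside with ⟨h2, h3⟩ | ⟨h2, h3, h4⟩
    · refine ih h' (fun x hx => ?_) (Or.inl ⟨by by_contra; exact h1 ⟨h2, by omega⟩, h3⟩)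
      rw [htape x hx, tape_of_step hs (by omega)]
    · obtain ⟨d', e1, e2, e3, e4⟩ := both hs h2 h3 h4 htape
      cases h' with
      | halt hn => rw [e1] at hn; cases hn
      | enter => omega
      | stay hs' _ ht =>
        obtain rfl := Option.some.inj (e1.symm.trans hs')
        refine ih ht e4 ?_
        rcases lt_or_ge d.head i with h | h
        · exact Or.inl ⟨h, by omega⟩
        · exact Or.inr ⟨h, e2, e3⟩

/-- A list of length at most `V` is determined by its `V` optional entries. -/
theorem card_lists_le {α : Type*} [Finite α] (V : ℕ) (S : Finset (List α))
    (hS : ∀ l ∈ S, l.length ≤ V) : S.card ≤ (Nat.card α + 1) ^ V := by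
  have : Fintype α := Fintype.ofFinite α
  have hinj : Set.InjOn (fun (l : List α) (k : Fin V) => l[(k : ℕ)]?) S := by
    intro l hl l' hl' e
    refine List.ext_getElem? fun n => ?_
    by_cases hn : n < V
    · exact congrFun e ⟨n, hn⟩
    · rw [List.getElem?_eq_none ((hS l hl).trans (not_lt.1 hn)),
        List.getElem?_eq_none ((hS l' hl').trans (not_lt.1 hn))]
  classical
  calc S.card ≤ (Finset.univ : Finset (Fin V → Option α)).card :=
        Finset.card_le_card_of_injOn _ (fun _ _ => Finset.mem_univ _) hinj
    _ = (Nat.card α + 1) ^ V := by simp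

/-- In a halting computation the head does not go far into the blank part of the tape. -/
theorem WeightReducing.head_le {M : DTM A} (hM : M.WeightReducing) {c f : M.Cfg} {m : ℤ}
    (hf : f ∈ StateTransition.eval M.step c) (hc : c.head < m) (hblank : ∀ x ≥ m, c.tape x = M.blank)
    {d : M.Cfg} (hd : M.Reaches c d) :
    d.head ≤ m + ((Nat.card M.State + 1) ^ Nat.card M.Symbol : ℕ) := by
  classical
  obtain ⟨hcf, hend⟩ := StateTransition.mem_eval.1 hf
  obtain ⟨g, hg, hgb⟩ := hM.exists_rank
  set N := (Nat.card M.State + 1) ^ Nat.card M.Symbol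
  choose E hE using exists_trace hcf hend
  have hlen : ∀ i ≥ m, (E i).length ≤ Nat.card M.Symbol := by
    intro i hi
    have := (hE i).length_le hg
    rw [if_pos (by omega)] at this
    exact this.trans (hgb _)
  -- a cell far to the right is never rewritten
  have key : ∀ y, f.tape y ≠ M.blank → y < m + N := by
    intro y hy
    by_contra! hlt
    have hcard : ((Finset.Icc m y).image E).card ≤ N := by
      refine card_lists_le _ _ fun l hl => ?_
      obtain ⟨i, hi, rfl⟩ := Finset.mem_image.1 hl
      exact hlen i (Finset.mem_Icc.1 hi).1
    have hlt : ((Finset.Icc m y).image E).card < (Finset.Icc m y).card := by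
      rw [Int.card_Icc]; omega
    have : ∃ i ∈ Finset.Icc m y, ∃ j ∈ Finset.Icc m y, i ≠ j ∧ E i = E j :=
      Finset.exists_ne_map_eq_of_card_lt_of_maps_to hlt
        (fun x hx => Finset.mem_coe.2 (Finset.mem_image_of_mem E hx))
    obtain ⟨i, j, hi, hij, hj, e⟩ : ∃ i j, m ≤ i ∧ i < j ∧ j ≤ y ∧ E i = E j := by
      obtain ⟨i, hi, j, hj, hne, e⟩ := this
      rw [Finset.mem_Icc] at hi hj
      rcases lt_or_gt_of_ne hne with h | h
      · exact ⟨i, j, hi.1, h, hj.2, e⟩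
      · exact ⟨j, i, hj.1, h, hi.2, e.symm⟩
    obtain ⟨k, rfl⟩ : ∃ k, j = i + k := ⟨j - i, by ring⟩
    -- The computation is compared with itself at two boundaries. The nonblank cell `y` then recurs
    -- with period `k`, although only finitely many cells are ever rewritten.
    have hshift : ∀ x ≥ i, f.tape (x + k) = f.tape x :=
      (hE i).tape_eq (e ▸ hE (i + k)) (fun x hx => by
        rw [hblank _ (by omega), hblank _ (by omega)]) (Or.inl ⟨by omega, by omega⟩)
    have hall : ∀ n : ℕ, f.tape (y + n * k) ≠ M.blank := by
      intro n
      induction n with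
      | zero => simpa using hy
      | succ n ih =>
        have h0 : 0 ≤ (n : ℤ) * k := by apply mul_nonneg <;> omega
        rw [show y + ((n + 1 : ℕ) : ℤ) * k = (y + n * k) + k by push_cast; ring,
          hshift _ (by omega)]
        exact ih
    obtain ⟨B, hB⟩ := exists_tape_eq_of_reaches hcf
    have hk : ((B - y).toNat : ℤ) ≤ (B - y).toNat * k := by
      nlinarith [Int.natCast_nonneg (B - y).toNat]
    have h0 : y ≤ y + (B - y).toNat * k := by omega
    apply hall (B - y).toNat
    rw [hB _ (by omega), hblank _ (by omega)]
  induction hd with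
  | refl => omega
  | @tail b d hb h _ =>
    have hdf : M.Reaches d f := by
      rcases StateTransition.reaches_total (hb.tail h) hcf with h' | h'
      · exact h'
      · rcases ReflTransGen.cases_head h' with rfl | ⟨e, he, -⟩
        · exact ReflTransGen.refl
        · rw [Option.mem_def, hend] at he; cases he
    -- The cell left by this step is still nonblank at the end, hence before `m + N`; the head is at
    -- most one cell further.
    have := key b.head (tape_ne_blank_of_reaches hdf (tape_head_of_step h))
    have := head_of_step h
    omega

/-! ### Mirror images -/

/-- The machine with left and right exchanged. -/
def mirror (M : DTM A) : DTM A where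
  State := M.State
  Symbol := M.Symbol
  input := M.input
  blank := M.blank
  blank_not_input := M.blank_not_input
  δ p σ := (M.δ p σ).map fun r => (r.1, r.2.1, match r.2.2 with
    | Turing.Dir.left => Turing.Dir.right
    | Turing.Dir.right => Turing.Dir.left)
  blank_not_written := by
    intro p σ q τ d h
    obtain ⟨⟨q', τ', d'⟩, h1, h2⟩ := Option.map_eq_some_iff.1 h
    cases h2
    exact M.blank_not_written _ _ _ _ _ h1
  start := M.start
  final := M.final

theorem IsRank.mirror {M : DTM A} {f : M.Symbol → ℕ} (hf : M.IsRank f) : M.mirror.IsRank f := by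
  intro p σ q τ d h
  obtain ⟨⟨q', τ', d'⟩, h1, h2⟩ := Option.map_eq_some_iff.1 h
  cases h2
  exact hf _ _ _ _ _ h1

theorem WeightReducing.mirror {M : DTM A} (h : M.WeightReducing) : M.mirror.WeightReducing := by
  obtain ⟨f, hf, -⟩ := h.exists_rank
  exact hf.mirror.weightReducing

/-- The mirror image of a configuration. -/
def Cfg.mirror {M : DTM A} (c : M.Cfg) : M.mirror.Cfg where
  state := c.state
  tape := fun x => c.tape (-x)
  head := -c.head

theorem step_mirror {M : DTM A} (c : M.Cfg) :
    M.mirror.step c.mirror = (M.step c).map Cfg.mirror := by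
  have : M.mirror.δ c.mirror.state (c.mirror.tape c.mirror.head) =
      M.mirror.δ c.state (c.tape c.head) := by simp [Cfg.mirror]
  simp only [step, this]
  simp only [DTM.mirror]
  rcases M.δ c.state (c.tape c.head) with _ | ⟨q, τ, d⟩
  · rfl
  · refine congrArg some (Cfg.ext rfl (fun x => ?_) ?_)
    · change Function.update (fun x => c.tape (-x)) (-c.head) τ x =
        Function.update c.tape c.head τ (-x)
      simp only [Function.update_apply, neg_eq_iff_eq_neg]
    · cases d
      · change -c.head + 1 = -(c.head + -1); ring
      · change -c.head + -1 = -(c.head + 1); ring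

theorem Reaches.mirror {M : DTM A} {c d : M.Cfg} (h : M.Reaches c d) :
    M.mirror.Reaches c.mirror d.mirror := by
  induction h with
  | refl => exact ReflTransGen.refl
  | tail _ h ih =>
    refine ih.tail ?_
    rw [Option.mem_def, step_mirror, Option.mem_def.1 h]; rfl

theorem exists_reaches_of_mirror {M : DTM A} {c : M.Cfg} {d : M.mirror.Cfg}
    (h : M.mirror.Reaches c.mirror d) : ∃ d', d = Cfg.mirror d' ∧ M.Reaches c d' := by
  induction h with
  | refl => exact ⟨c, rfl, ReflTransGen.refl⟩
  | @tail b d _ h ih =>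
    obtain ⟨b, rfl, hb⟩ := ih
    rw [Option.mem_def, step_mirror] at h
    obtain ⟨d', h1, h2⟩ := Option.map_eq_some_iff.1 h
    exact ⟨d', h2.symm, hb.tail h1⟩

theorem acceptsFrom_mirror {M : DTM A} {c : M.Cfg} :
    M.mirror.AcceptsFrom c.mirror ↔ M.AcceptsFrom c := by
  constructor
  · rintro ⟨d, h, hd⟩
    obtain ⟨h1, h2⟩ := StateTransition.mem_eval.1 h
    obtain ⟨d, rfl, h3⟩ := exists_reaches_of_mirror h1
    rw [step_mirror, Option.map_eq_none_iff] at h2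
    exact ⟨d, StateTransition.mem_eval.2 ⟨h3, h2⟩, hd⟩
  · rintro ⟨d, h, hd⟩
    obtain ⟨h1, h2⟩ := StateTransition.mem_eval.1 h
    refine ⟨d.mirror, StateTransition.mem_eval.2 ⟨Reaches.mirror h1, ?_⟩, hd⟩
    rw [step_mirror, h2]; rfl

/-! ### The fenced machine -/

/-- The states in which a fenced machine sets up its fence: it marks the start cell, walks over the
input, and then fills the blank cells with blocks of `n + 1` digits holding `0, 1, 2, …` in binary,
until a block of ones is found; there it puts the fence. A digit is `read`, carried `out` to the
next block, and the head comes `back` for the next one. -/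
inductive Prep (n : ℕ)
  | init
  | read (j : Fin (n + 1)) (c : Bool)
  | out (j : Fin (n + 1)) (c b : Bool) (k : Fin (n + 1))
  | back (j : Fin (n + 1)) (c : Bool) (k : Fin (n + 1))
  | ret
  | bounce
  | reject

/-- Encoding of the set-up states, for counting them. -/
def Prep.code {n : ℕ} : Prep n → Fin 7 × Fin (n + 1) × Bool × Bool × Fin (n + 1)
  | init => (0, 0, false, false, 0)
  | read j c => (1, j, c, false, 0)
  | out j c b k => (2, j, c, b, k)
  | back j c k => (3, j, c, false, k)
  | ret => (4, 0, false, false, 0)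
  | bounce => (5, 0, false, false, 0)
  | reject => (6, 0, false, false, 0)

theorem Prep.code_injective {n : ℕ} : Function.Injective (Prep.code (n := n)) := by
  intro p q h
  cases p <;> cases q <;> simp_all [Prep.code]

instance {n : ℕ} : Finite (Prep n) := Finite.of_injective _ Prep.code_injective

theorem Prep.card_le (n : ℕ) : Nat.card (Prep n) ≤ 28 * (n + 1) ^ 2 := by
  refine (Nat.card_le_card_of_injective _ Prep.code_injective).trans ?_
  simp only [Nat.card_eq_fintype_card, Fintype.card_prod, Fintype.card_fin, Fintype.card_bool]
  apply le_of_eq; ring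

/-- Put the layer `v` on a symbol, provided that this lowers the layer. -/
def put {Γ ρ : Type*} {B : ℕ} (γ : Γ) (l : Fin B) (v : ℕ) (b : Bool) (r : ρ) (d : Turing.Dir) :
    Option (ρ × (Γ × Fin B × Bool) × Turing.Dir) :=
  if h : v < l then some (r, (γ, ⟨v, h.trans l.2⟩, b), d) else none

theorem of_put_eq_some {Γ ρ : Type*} {B : ℕ} {γ : Γ} {l : Fin B} {v : ℕ} {b : Bool} {r : ρ}
    {d : Turing.Dir} {q τ e} (h : put γ l v b r d = some (q, τ, e)) :
    τ.1 = γ ∧ τ.2.1 < l := by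
  unfold put at h
  split_ifs at h with hv
  cases h
  exact ⟨rfl, hv⟩

open Classical in
/-- The transitions of the set-up phase. -/
noncomputable def prepδ (M : DTM A) (n : ℕ) (γ : M.Symbol) (l : Fin (2 * n + 8)) (b : Bool) :
    Prep n → Option ((M.State ⊕ Prep n) × (M.Symbol × Fin (2 * n + 8) × Bool) × Turing.Dir)
  | .init => put γ l 2 false (.inr (.read 0 true)) .right
  | .read j c =>
    -- The input is crossed in the reading state; the first blank is then taken as the first digit.
    if γ ≠ M.blank then put γ l 3 false (.inr (.read j c)) .right
    else if h : j.val + 1 < n + 1 then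
      put γ l 4 b (.inr (.out ⟨j + 1, h⟩ (c && b) (b ^^ c) 0)) .right
    -- End of a block with the carry alive: all its digits are ones, and the fence is put here.
    else if c && b then put γ l 4 true (.inr .ret) .left
    else put γ l 4 b (.inr (.out 0 true (b ^^ c) 0)) .right
  | .out j c β k =>
    if h : k.val + 1 < n + 1 then put γ l (2 * k + 6) b (.inr (.out j c β ⟨k + 1, h⟩)) .right
    else put γ l (2 * k + 6) β (.inr (.back j c k)) .left
  | .back j c k =>
    if k.val = 0 then put γ l 3 b (.inr (.read j c)) .right
    else put γ l (2 * k + 3) b (.inr (.back j c ⟨k - 1, by omega⟩)) .left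
  | .ret =>
    -- On the way back only the start cell has a layer below 3.
    if l.val < 3 then put γ l 1 false (.inr .bounce) .right
    else put γ l 1 false (.inr .ret) .left
  | .bounce => put γ l 0 b (.inl M.start) .left
  | .reject => none

theorem of_prepδ_eq_some {M : DTM A} {n : ℕ} {γ : M.Symbol} {l : Fin (2 * n + 8)} {b : Bool}
    {p : Prep n} {q τ e} (h : M.prepδ n γ l b p = some (q, τ, e)) : τ.1 = γ ∧ τ.2.1 < l := by
  cases p <;> simp only [prepδ] at h <;> (try split_ifs at h) <;>
    first | exact of_put_eq_some h | cases h

/-- The transitions of the fenced machine: set-up, then simulation of `M` until the fence is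
touched. -/
noncomputable def fenceδ (M : DTM A) (n : ℕ) (p : M.State ⊕ Prep n)
    (σ : M.Symbol × Fin (2 * n + 8) × Bool) :
    Option ((M.State ⊕ Prep n) × (M.Symbol × Fin (2 * n + 8) × Bool) × Turing.Dir) :=
  match p with
  | .inl q =>
    if σ.2.2 then put σ.1 σ.2.1 0 false (.inr .reject) .left
    else (M.δ q σ.1).map fun r => (.inl r.1, (r.2.1, 0, false), r.2.2)
  | .inr p => M.prepδ n σ.1 σ.2.1 σ.2.2 p

theorem of_fenceδ_eq_some {M : DTM A} {n : ℕ} {p σ q τ e}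
    (h : M.fenceδ n p σ = some (q, τ, e)) :
    (τ.1 = σ.1 ∧ τ.2.1 < σ.2.1) ∨
      ∃ p' q', M.δ p' σ.1 = some (q', τ.1, e) ∧ τ.2.1 = 0 := by
  cases p with
  | inl p =>
    simp only [fenceδ] at h
    split_ifs at h
    · exact Or.inl (of_put_eq_some h)
    · obtain ⟨r, h1, h2⟩ := Option.map_eq_some_iff.1 h
      cases h2
      exact Or.inr ⟨_, _, h1, rfl⟩
  | inr p => exact Or.inl (of_prepδ_eq_some h)

/-- The machine that builds a fence far to the right of the input, returns, and simulates `M`,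
rejecting when the fence is touched. -/
noncomputable def fence (M : DTM A) (n : ℕ) : DTM A where
  State := M.State ⊕ Prep n
  Symbol := M.Symbol × Fin (2 * n + 8) × Bool
  input := ⟨fun a => (M.input a, Fin.last _, false), fun a b h => M.input.injective (by simpa using h)⟩
  blank := (M.blank, Fin.last _, false)
  blank_not_input a h := M.blank_not_input a (congrArg Prod.fst h)
  δ := M.fenceδ n
  blank_not_written := by
    rintro p σ q τ d h rfl
    rcases of_fenceδ_eq_some h with ⟨-, h⟩ | ⟨p', q', h, -⟩
    · exact absurd h (not_lt.2 (Fin.le_last _))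
    · exact M.blank_not_written _ _ _ _ _ h rfl
  start := .inr .init
  final := Sum.inl '' M.final

theorem WeightReducing.fence {M : DTM A} (h : M.WeightReducing) (n : ℕ) :
    (M.fence n).WeightReducing := by
  obtain ⟨f, hf, -⟩ := h.exists_rank
  -- A set-up or rejecting step keeps the content and lowers the layer; a simulated step lowers the
  -- rank of the content and sets the layer to 0.
  refine IsRank.weightReducing (f := fun σ => f σ.1 + σ.2.1) ?_
  intro p σ q τ d h
  rcases of_fenceδ_eq_some h with ⟨h1, h2⟩ | ⟨p', q', h1, h2⟩
  · simp only [h1]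
    have : (τ.2.1 : ℕ) < σ.2.1 := h2
    omega
  · have := hf _ _ _ _ _ h1
    simp only [h2, Fin.val_zero]
    omega

/-! ### The sequence of digits -/

/-- The `i`-th cell in the sequence of blocks. -/
def digit (n i : ℕ) : Bool := (i / (n + 1)).testBit (i % (n + 1))

/-- The carry into the `i`-th digit when its block is incremented. -/
def carry (n i : ℕ) : Bool :=
  decide (i / (n + 1) % 2 ^ (i % (n + 1)) = 2 ^ (i % (n + 1)) - 1)

theorem digit_of_lt {n i : ℕ} (h : i < n + 1) : digit n i = false := by
  simp [digit, Nat.div_eq_of_lt h]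

theorem carry_zero (n : ℕ) : carry n 0 = true := by simp [carry]

theorem mod_two_pow_succ_eq (k j : ℕ) :
    k % 2 ^ (j + 1) = k % 2 ^ j + 2 ^ j * (k.testBit j).toNat := by
  rw [Nat.mod_pow_succ, Nat.toNat_testBit]

theorem mod_two_pow_succ_eq_sub_one_iff (k j : ℕ) :
    k % 2 ^ (j + 1) = 2 ^ (j + 1) - 1 ↔ k % 2 ^ j = 2 ^ j - 1 ∧ k.testBit j = true := by
  have := mod_two_pow_succ_eq k j
  have h2 : k % 2 ^ j < 2 ^ j := Nat.mod_lt _ (by positivity)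
  have h3 : 2 ^ (j + 1) = 2 * 2 ^ j := by ring
  cases h : k.testBit j <;> simp only [h, Bool.toNat_false, Bool.toNat_true, mul_zero, mul_one] at this
  · simp; omega
  · simp; omega

/-- Adding one flips a bit exactly when all lower bits are ones. -/
theorem testBit_succ_eq_xor (k j : ℕ) :
    (k + 1).testBit j = (k.testBit j ^^ decide (k % 2 ^ j = 2 ^ j - 1)) := by
  have h2 : k % 2 ^ j < 2 ^ j := Nat.mod_lt _ (by positivity)
  have hk := Nat.div_add_mod k (2 ^ j)
  simp only [Nat.testBit_eq_decide_div_mod_eq]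
  by_cases h : k % 2 ^ j = 2 ^ j - 1
  · have : (k + 1) / 2 ^ j = k / 2 ^ j + 1 := by
      have e : k + 1 = 2 ^ j * (k / 2 ^ j + 1) := by rw [mul_add]; omega
      conv_lhs => rw [e]
      exact Nat.mul_div_cancel_left _ (by positivity)
    rw [this, h]
    rcases Nat.mod_two_eq_zero_or_one (k / 2 ^ j) with e | e <;> simp [Nat.add_mod, e]
  · have : (k + 1) / 2 ^ j = k / 2 ^ j := by
      refine Nat.div_eq_of_lt_le ?_ ?_
      · rw [mul_comm]; omega
      · rw [add_mul, mul_comm]; omega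
    rw [this]; simp [h]

theorem digit_add (n i : ℕ) : digit n (i + (n + 1)) = (digit n i ^^ carry n i) := by
  rw [digit, Nat.add_div_right _ n.succ_pos, Nat.add_mod_right, testBit_succ_eq_xor]
  rfl

theorem carry_succ_of_lt {n i : ℕ} (h : i % (n + 1) + 1 < n + 1) :
    (i + 1) % (n + 1) = i % (n + 1) + 1 ∧ carry n (i + 1) = (carry n i && digit n i) := by
  have h1 : (i + 1) / (n + 1) = i / (n + 1) := by
    rw [Nat.succ_div_of_not_dvd]
    rw [Nat.dvd_iff_mod_eq_zero, Nat.add_mod]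
    rw [Nat.mod_eq_of_lt (a := 1) (by omega), Nat.mod_eq_of_lt h]; omega
  have h2 : (i + 1) % (n + 1) = i % (n + 1) + 1 := by
    rw [Nat.add_mod, Nat.mod_eq_of_lt (a := 1) (by omega), Nat.mod_eq_of_lt h]
  refine ⟨h2, ?_⟩
  rw [Bool.eq_iff_iff]
  simp only [carry, h1, h2, mod_two_pow_succ_eq_sub_one_iff, digit, Bool.and_eq_true,
    decide_eq_true_eq]

theorem carry_succ_of_not_lt {n i : ℕ} (h : ¬ i % (n + 1) + 1 < n + 1) :
    (i + 1) % (n + 1) = 0 ∧ carry n (i + 1) = true := by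
  have h0 : i % (n + 1) < n + 1 := Nat.mod_lt i n.succ_pos
  have h2 : (i + 1) % (n + 1) = 0 := by
    rw [← Nat.mod_add_mod, show i % (n + 1) + 1 = n + 1 by omega, Nat.mod_self]
  exact ⟨h2, by simp [carry, h2, Nat.mod_one]⟩

/-- The position of the last digit of the first block consisting of ones. -/
def fencePos (n : ℕ) : ℕ := (n + 1) * 2 ^ (n + 1) - 1

theorem fencePos_add_one (n : ℕ) : fencePos n + 1 = (n + 1) * 2 ^ (n + 1) := by
  have : 0 < (n + 1) * 2 ^ (n + 1) := by positivity
  unfold fencePos; omega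

theorem fencePos_mod (n : ℕ) : fencePos n % (n + 1) = n := by
  obtain ⟨k, hk⟩ : ∃ k, 2 ^ (n + 1) = k + 1 := Nat.exists_eq_succ_of_ne_zero (by positivity)
  have h := fencePos_add_one n
  rw [hk] at h
  have e : fencePos n = n + (n + 1) * k := by
    have : (n + 1) * (k + 1) = (n + (n + 1) * k) + 1 := by ring
    omega
  rw [e, Nat.add_mul_mod_self_left, Nat.mod_eq_of_lt (by omega)]

/-- At the end of a block, carry and digit are both set just when the block holds 2^(n+1) - 1; up to
`fencePos n` the block number fits into n + 1 digits. -/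
theorem carry_and_digit_iff {n i : ℕ} (hi : i ≤ fencePos n) (h : ¬ i % (n + 1) + 1 < n + 1) :
    (carry n i && digit n i) = true ↔ i = fencePos n := by
  have h0 : i % (n + 1) < n + 1 := Nat.mod_lt i n.succ_pos
  have h1 : i % (n + 1) = n := by omega
  have hi2 := Nat.div_add_mod i (n + 1)
  have hN := fencePos_add_one n
  have hlt : i / (n + 1) < 2 ^ (n + 1) := Nat.div_lt_of_lt_mul (by omega)
  rw [Bool.and_eq_true, carry, digit, decide_eq_true_eq, ← mod_two_pow_succ_eq_sub_one_iff, h1,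
    Nat.mod_eq_of_lt hlt]
  have hp : 0 < 2 ^ (n + 1) := by positivity
  constructor
  · intro e
    have : i / (n + 1) + 1 = 2 ^ (n + 1) := by omega
    rw [← this, mul_add] at hN
    omega
  · intro e
    have : (n + 1) * (i / (n + 1) + 1) = (n + 1) * 2 ^ (n + 1) := by rw [mul_add]; omega
    have := Nat.eq_of_mul_eq_mul_left n.succ_pos this
    omega

/-! ### Computation paths -/

/-- Every configuration satisfying `Φ` leads to one satisfying `Ψ`, and before that all
configurations satisfy `P`. -/
def Leads (M : DTM A) (P Φ Ψ : M.Cfg → Prop) : Prop :=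
  ∀ c, Φ c → ∃ d, Ψ d ∧ ReflTransGen (fun a b => M.step a = some b ∧ P a) c d

section Leads

variable {M : DTM A} {P Φ Ψ Ξ : M.Cfg → Prop}

theorem Leads.trans (h : M.Leads P Φ Ψ) (h' : M.Leads P Ψ Ξ) : M.Leads P Φ Ξ := by
  intro c hc
  obtain ⟨d, hd, h1⟩ := h c hc
  obtain ⟨e, he, h2⟩ := h' d hd
  exact ⟨e, he, h1.trans h2⟩

theorem Leads.of_imp (h : ∀ c, Φ c → Ψ c) : M.Leads P Φ Ψ :=
  fun c hc => ⟨c, h c hc, .refl⟩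

theorem Leads.of_step (h : ∀ c, Φ c → P c ∧ ∃ d, M.step c = some d ∧ Ψ d) : M.Leads P Φ Ψ := by
  intro c hc
  obtain ⟨h1, d, h2, h3⟩ := h c hc
  exact ⟨d, h3, .single ⟨h2, h1⟩⟩

theorem Leads.iterate {F : ℕ → M.Cfg → Prop} {a b : ℕ} (hab : a ≤ b)
    (h : ∀ i, a ≤ i → i < b → M.Leads P (F i) (F (i + 1))) : M.Leads P (F a) (F b) := by
  induction b, hab using Nat.le_induction with
  | base => exact .of_imp fun _ h => h
  | succ b hb ih => exact (ih fun i h1 h2 => h i h1 (by omega)).trans (h b hb (by omega))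

theorem Leads.iterate_down {F : ℕ → M.Cfg → Prop} (b : ℕ)
    (h : ∀ i, i < b → M.Leads P (F (i + 1)) (F i)) : M.Leads P (F b) (F 0) := by
  induction b with
  | zero => exact .of_imp fun _ h => h
  | succ b ih => exact (h b (by omega)).trans (ih fun i h1 => h i (by omega))

theorem reaches_of_path {c d : M.Cfg}
    (h : ReflTransGen (fun a b => M.step a = some b ∧ P a) c d) : M.Reaches c d :=
  ReflTransGen.mono (fun _ _ h => h.1) c d h

/-- By determinism a reachable configuration lies on the path or after its end. This turns the
invariant of the set-up paths into bounds on the head. -/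
theorem of_path_of_reaches {c d e : M.Cfg}
    (h : ReflTransGen (fun a b => M.step a = some b ∧ P a) c d) (he : M.Reaches c e) :
    P e ∨ M.Reaches d e := by
  induction h using ReflTransGen.head_induction_on with
  | refl => exact Or.inr he
  | head h _ ih =>
    rcases ReflTransGen.cases_head he with rfl | ⟨b, h1, h2⟩
    · exact Or.inl h.2
    · obtain rfl := Option.some.inj (h.1.symm.trans h1)
      exact ih h2

end Leads

/-! ### Setting up the fence -/

section Setup

variable {M : DTM A} {n : ℕ} {τ : ℤ → M.Symbol}

/-- A tape of the fenced machine over the tape `τ`, with layer `z` at the start cell, layers at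
least `lo`, and digits `bit`. -/
structure Good (M : DTM A) (n : ℕ) (τ : ℤ → M.Symbol) (z : ℕ) (lo : ℤ → ℕ) (bit : ℤ → Bool)
    (t : ℤ → M.Symbol × Fin (2 * n + 8) × Bool) : Prop where
  content : ∀ x, (t x).1 = τ x
  start : ((t 0).2.1 : ℕ) = z
  lo : ∀ x, lo x ≤ (t x).2.1
  bit : ∀ x, (t x).2.2 = bit x

theorem Good.update {z : ℕ} {lo lo' : ℤ → ℕ} {bit bit' : ℤ → Bool}
    {t : ℤ → M.Symbol × Fin (2 * n + 8) × Bool} (hc : Good M n τ z lo bit t) (h : ℤ)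
    (v : Fin (2 * n + 8)) (b : Bool) (hlo : ∀ x, lo' x ≤ Function.update lo h v x)
    (hbit : ∀ x, bit' x = Function.update bit h b x) :
    Good M n τ (if h = 0 then v else z) lo' bit' (Function.update t h (τ h, v, b)) := by
  refine ⟨fun x => ?_, ?_, fun x => (hlo x).trans ?_, fun x => (hbit x).symm ▸ ?_⟩ <;>
    simp only [Function.update_apply]
  · split_ifs with e
    · rw [e]
    · exact hc.content x
  · simp only [eq_comm (a := (0 : ℤ))]
    split_ifs
    · rfl
    · exact hc.start
  · split_ifs
    · exact le_rfl
    · exact hc.lo x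
  · split_ifs
    · rfl
    · exact hc.bit x

/-- The configurations with given state and head position and a `Good` tape. -/
def At (M : DTM A) (n : ℕ) (τ : ℤ → M.Symbol) (r : M.State ⊕ Prep n) (h : ℤ) (lo : ℤ → ℕ)
    (bit : ℤ → Bool) (c : (M.fence n).Cfg) : Prop :=
  c.state = r ∧ c.head = h ∧ Good M n τ 2 lo bit c.tape

/-- Lower bounds on the layers suffice, since `put` only needs room below the old layer. The layer
of the start cell is tracked exactly because the returning head recognizes the cell by it. -/
theorem step_of_put {r : Prep n} {c : (M.fence n).Cfg} {z v : ℕ} {b : Bool} {r' d}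
    {lo lo' : ℤ → ℕ} {bit bit' : ℤ → Bool} {h : ℤ}
    (hr : c.state = .inr r) (hh : c.head = h) (hc : Good M n τ z lo bit c.tape)
    (hδ : ∀ l : Fin (2 * n + 8), lo h ≤ l → (h = 0 → (l : ℕ) = z) →
      M.prepδ n (τ h) l (bit h) r = put (τ h) l v b r' d)
    (hv : v < lo h ∨ (h = 0 ∧ v < z)) (hlo : ∀ x, lo' x ≤ Function.update lo h v x)
    (hbit : ∀ x, bit' x = Function.update bit h b x) :
    ∃ c', (M.fence n).step c = some c' ∧ c'.state = r' ∧ c'.head = h + shift d ∧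
      Good M n τ (if h = 0 then v else z) lo' bit' c'.tape := by
  subst hh
  have hz : c.head = 0 → ((c.tape c.head).2.1 : ℕ) = z := fun e => by rw [e]; exact hc.start
  have hlt : v < (c.tape c.head).2.1 := by
    rcases hv with hv | ⟨h0, hv⟩
    · exact hv.trans_le (hc.lo _)
    · rw [hz h0]; exact hv
  have h1 : (M.fence n).δ c.state (c.tape c.head) =
      some (r', (τ c.head, ⟨v, hlt.trans (c.tape c.head).2.1.2⟩, b), d) := by
    change M.fenceδ n c.state (c.tape c.head) = _
    rw [hr]
    simp only [fenceδ]
    rw [hc.content, hc.bit, hδ _ (hc.lo _) hz, put, dif_pos hlt]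
  exact ⟨_, step_of_δ h1, rfl, rfl, hc.update _ ⟨v, _⟩ b hlo hbit⟩

theorem leads_put {r : Prep n} {v : ℕ} {b : Bool} {r' d} {X : ℕ}
    {lo lo' : ℤ → ℕ} {bit bit' : ℤ → Bool} {h h' : ℤ}
    (hδ : ∀ l : Fin (2 * n + 8), lo h ≤ l →
      M.prepδ n (τ h) l (bit h) r = put (τ h) l v b r' d)
    (hh : 0 < h) (hX : h ≤ X) (hh' : h' = h + shift d)
    (hv : v < lo h) (hlo : ∀ x, lo' x ≤ Function.update lo h v x)
    (hbit : ∀ x, bit' x = Function.update bit h b x) :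
    (M.fence n).Leads (fun c => 0 ≤ c.head ∧ c.head ≤ X)
      (At M n τ (.inr r) h lo bit) (At M n τ r' h' lo' bit') := by
  refine .of_step fun c ⟨h1, h2, h3⟩ => ⟨by omega, ?_⟩
  obtain ⟨c', e1, e2, e3, e4⟩ := step_of_put h1 h2 h3 (fun l hl _ => hδ l hl) (Or.inl hv) hlo hbit
  rw [if_neg hh.ne'] at e4
  exact ⟨c', e1, e2, by rw [e3, hh'], e4⟩

theorem leads_weaken {r : M.State ⊕ Prep n} {P} {lo lo' : ℤ → ℕ} {bit bit' : ℤ → Bool} {h : ℤ}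
    (hlo : ∀ x, lo' x ≤ lo x) (hbit : ∀ x, bit' x = bit x) :
    (M.fence n).Leads P (At M n τ r h lo bit) (At M n τ r h lo' bit') :=
  .of_imp fun _ ⟨h1, h2, h3⟩ => ⟨h1, h2, h3.content, h3.start, fun x => (hlo x).trans (h3.lo x),
    fun x => by rw [h3.bit, hbit]⟩

/-- Lower bounds for the layers while the head walks over the input. -/
def loWalk (n p : ℕ) (x : ℤ) : ℕ :=
  if x ≤ 0 then 0 else if x < p then 3 else 2 * n + 7

/-- Lower bounds for the layers before the digit in cell `s` is read. -/
def loRead (n s : ℕ) (x : ℤ) : ℕ :=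
  if x ≤ 0 then 0 else if x < s then 3 else if x < s + n + 1 then 2 * (x - s).toNat + 5
  else 2 * n + 7

/-- Lower bounds for the layers while the digit in cell `s` is carried to the next block. -/
def loOut (n s k : ℕ) (x : ℤ) : ℕ :=
  if s ≤ x ∧ x ≤ s + k then 2 * (x - s).toNat + 4 else loRead n s x

/-- Lower bounds for the layers while the head comes back to cell `s`. -/
def loBack (n s k : ℕ) (x : ℤ) : ℕ :=
  if s ≤ x ∧ x ≤ s + k then 2 * (x - s).toNat + 4
  else if s + k < x ∧ x ≤ s + n + 1 then 2 * (x - s).toNat + 3 else loRead n s x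

/-- Lower bounds for the layers while the head returns from the fence at `X`. -/
def loRet (X p : ℕ) (x : ℤ) : ℕ :=
  if x ≤ 0 then 0 else if x ≤ p then 3 else if x < X then 1 else if x = X then 4 else 0

/-- The digits on the tape before the digit `i` is read, the first block starting at `m`. -/
def bits (n m i : ℕ) (x : ℤ) : Bool :=
  if m ≤ x ∧ x < m + i + n + 1 then digit n (x - m).toNat else false

/-- The digits on the tape while the head returns from the fence at `X`. -/
def bitsRet (n m X p : ℕ) (x : ℤ) : Bool :=
  if p < x ∧ x < X then false else if x = X then true else bits n m (X - m) x

/-- The state in which the digit in the `i`-th cell of the blocks is read. -/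
abbrev Prep.readAt (n i : ℕ) : Prep n := .read ⟨i % (n + 1), Nat.mod_lt i n.succ_pos⟩ (carry n i)

theorem leads_walk {m X : ℕ} (hm : 1 ≤ m) (hX : m ≤ X)
    (hin : ∀ x : ℤ, 0 < x → x < m → τ x ≠ M.blank) :
    (M.fence n).Leads (fun c => 0 ≤ c.head ∧ c.head ≤ X)
      (At M n τ (.inr (.read 0 true)) 1 (loWalk n 1) fun _ => false)
      (At M n τ (.inr (.readAt n 0)) (m + 0 : ℕ) (loRead n (m + 0)) (bits n m 0)) := by
  have h1 := Leads.iterate (M := M.fence n) (P := fun c => 0 ≤ c.head ∧ c.head ≤ X)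
    (F := fun p => At M n τ (.inr (.read 0 true)) p (loWalk n p) fun _ => false) hm ?_
  · refine h1.trans ?_
    have e : Prep.readAt n 0 = .read 0 true := by simp [Prep.readAt, carry_zero]
    rw [e]
    refine leads_weaken (fun x => ?_) (fun x => ?_)
    · simp only [loWalk, loRead]
      split_ifs <;> omega
    · simp only [bits]
      split_ifs
      · exact digit_of_lt (by omega)
      · rfl
  · intro p hp hpm
    refine leads_put (v := 3) (b := false) (d := .right) (fun l _ => ?_) (by omega) (by omega)
      (by simp) ?_ (fun x => ?_) (fun x => ?_)
    · simp only [prepδ]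
      rw [if_pos (hin p (by omega) (by omega))]
    · simp only [loWalk]
      split_ifs <;> omega
    · simp only [Function.update_apply, loWalk]
      split_ifs <;> omega
    · simp only [Function.update_apply, ite_self]

/-- Before the digit in `s` is read, the cell `s + k` has layer at least `2k + 5` for `k ≤ n + 1`.
The way out lowers this by one and the way back, for `k ≤ n`, by one more, leaving `2k + 3`: just
what is needed for reading `s + 1`. -/
theorem leads_out {s X : ℕ} (hs : 1 ≤ s) (hX : s + n + 1 ≤ X) (j c b) (bit bit' : ℤ → Bool)
    (hbit : ∀ x, bit' x = Function.update bit (s + n + 1 : ℕ) b x) :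
    (M.fence n).Leads (fun c => 0 ≤ c.head ∧ c.head ≤ X)
      (At M n τ (.inr (.out j c b 0)) (s + 1 : ℕ) (loOut n s 0) bit)
      (At M n τ (.inr (.back j c (Fin.last n))) (s + n : ℕ) (loBack n s n) bit') := by
  have h1 := Leads.iterate (M := M.fence n) (P := fun c => 0 ≤ c.head ∧ c.head ≤ X)
    (F := fun k => At M n τ (.inr (.out j c b (Fin.ofNat _ k))) (s + k + 1 : ℕ) (loOut n s k) bit)
    (Nat.zero_le n) ?_
  · refine h1.trans ?_
    have e : Fin.ofNat (n + 1) n = Fin.last n := by ext; simp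
    rw [e]
    refine leads_put (v := 2 * n + 6) (b := b) (d := .left) (fun l _ => ?_) (by omega) (by omega)
      (by push_cast; simp) ?_ (fun x => ?_) hbit
    · simp only [prepδ]
      rw [dif_neg (by simp)]
      simp
    · simp only [loOut, loRead]
      split_ifs <;> omega
    · simp only [Function.update_apply, loBack, loOut, loRead]
      split_ifs <;> omega
  · intro k _ hk
    have e : (Fin.ofNat (n + 1) k).val = k := Nat.mod_eq_of_lt (by omega)
    refine leads_put (v := 2 * k + 6) (b := bit (s + k + 1 : ℕ)) (d := .right) (fun l _ => ?_)
      (by omega) (by omega) (by push_cast; simp; ring) ?_ (fun x => ?_) (fun x => ?_)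
    · simp only [prepδ]
      rw [dif_pos (by omega)]
      congr 1
      · omega
      · congr 2
        ext; simp only [Fin.ofNat]
        rw [Nat.mod_eq_of_lt (a := k) (by omega), Nat.mod_eq_of_lt (a := k + 1) (by omega)]
    · simp only [loOut, loRead]
      split_ifs <;> omega
    · simp only [Function.update_apply, loOut, loRead]
      split_ifs <;> omega
    · rw [Function.update_eq_self]

theorem leads_back {s X : ℕ} (hs : 1 ≤ s) (hX : s + n + 1 ≤ X) (j c) (bit : ℤ → Bool) :
    (M.fence n).Leads (fun c => 0 ≤ c.head ∧ c.head ≤ X)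
      (At M n τ (.inr (.back j c (Fin.last n))) (s + n : ℕ) (loBack n s n) bit)
      (At M n τ (.inr (.read j c)) (s + 1 : ℕ) (loRead n (s + 1)) bit) := by
  have h1 := Leads.iterate_down (M := M.fence n) (P := fun c => 0 ≤ c.head ∧ c.head ≤ X)
    (F := fun k => At M n τ (.inr (.back j c (Fin.ofNat _ k))) (s + k : ℕ) (loBack n s k) bit)
    n ?_
  · have e : Fin.ofNat (n + 1) n = Fin.last n := by ext; simp
    rw [e] at h1
    refine h1.trans ?_
    refine leads_put (v := 3) (b := bit (s + 0 : ℕ)) (d := .right) (fun l _ => ?_) (by omega)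
      (by omega) (by push_cast; simp) ?_ (fun x => ?_) (fun x => ?_)
    · simp only [prepδ]
      rw [if_pos (by simp)]
    · simp only [loBack, loRead]
      split_ifs <;> omega
    · simp only [Function.update_apply, loBack, loRead]
      split_ifs <;> omega
    · rw [Function.update_eq_self]
  · intro k hk
    have e : (Fin.ofNat (n + 1) (k + 1)).val = k + 1 := Nat.mod_eq_of_lt (by omega)
    refine leads_put (v := 2 * (k + 1) + 3) (b := bit (s + (k + 1) : ℕ)) (d := .left) (fun l _ => ?_)
      (by omega) (by omega) (by push_cast; simp; ring) ?_ (fun x => ?_) (fun x => ?_)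
    · simp only [prepδ]
      rw [if_neg (by omega)]
      congr 1
      · omega
      · congr 2
        ext; simp only [Fin.ofNat]
        rw [Nat.mod_eq_of_lt (a := k) (by omega), Nat.mod_eq_of_lt (a := k + 1) (by omega)]
        omega
    · simp only [loBack, loRead]
      split_ifs <;> omega
    · simp only [Function.update_apply, loBack, loRead]
      split_ifs <;> omega
    · rw [Function.update_eq_self]

theorem bits_self (n m i : ℕ) : bits n m i (m + i : ℕ) = digit n i := by
  rw [bits, if_pos (by omega)]
  congr 1
  omega

/-- The digit, xored with the carry, goes n + 1 cells further, as in `digit_add`; the digits passed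
over are put back unchanged. -/
theorem leads_digit {m i X : ℕ} (hm : 1 ≤ m) (hi : i < fencePos n)
    (hX : m + fencePos n + n ≤ X) (hblank : ∀ x : ℤ, m ≤ x → τ x = M.blank) :
    (M.fence n).Leads (fun c => 0 ≤ c.head ∧ c.head ≤ X)
      (At M n τ (.inr (.readAt n i)) (m + i : ℕ) (loRead n (m + i)) (bits n m i))
      (At M n τ (.inr (.readAt n (i + 1))) (m + (i + 1) : ℕ) (loRead n (m + (i + 1)))
        (bits n m (i + 1))) := by
  have hmod : i % (n + 1) < n + 1 := Nat.mod_lt i n.succ_pos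
  have h1 : (M.fence n).Leads (fun c => 0 ≤ c.head ∧ c.head ≤ X)
      (At M n τ (.inr (.readAt n i)) (m + i : ℕ) (loRead n (m + i)) (bits n m i))
      (At M n τ (.inr (.out ⟨(i + 1) % (n + 1), Nat.mod_lt _ n.succ_pos⟩ (carry n (i + 1))
        (digit n (i + (n + 1))) 0)) (m + i + 1 : ℕ) (loOut n (m + i) 0) (bits n m i)) := by
    refine leads_put (v := 4) (b := digit n i) (d := .right) (fun l _ => ?_) (by omega) (by omega)
      (by simp) ?_ (fun x => ?_) (fun x => ?_)
    · simp only [prepδ]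
      rw [if_neg (by rw [hblank _ (by omega)]; simp), bits_self, digit_add]
      by_cases h : i % (n + 1) + 1 < n + 1
      · rw [dif_pos h]
        simp only [carry_succ_of_lt h]
      · rw [dif_neg h, if_neg (mt (carry_and_digit_iff hi.le h).1 hi.ne)]
        simp only [carry_succ_of_not_lt h]
        rfl
    · simp only [loRead]
      split_ifs <;> omega
    · simp only [Function.update_apply, loOut, loRead]
      split_ifs <;> omega
    · rw [← bits_self n m i, Function.update_eq_self]
  refine h1.trans (.trans ?_ (leads_back (s := m + i) (by omega) (by omega) _ _ _))
  refine leads_out (s := m + i) (by omega) (by omega) _ _ _ _ _ fun x => ?_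
  simp only [Function.update_apply, bits]
  split_ifs
  any_goals first | rfl | omega
  congr 1
  omega

/-- The returning head erases the digits left of the fence. Those beyond it remain, but the
simulation never gets there. -/
theorem leads_ret {m X : ℕ} (hm : 1 ≤ m) (hX : X = m + fencePos n)
    (hblank : ∀ x : ℤ, m ≤ x → τ x = M.blank) :
    (M.fence n).Leads (fun c => 0 ≤ c.head ∧ c.head ≤ (X + n : ℕ))
      (At M n τ (.inr (.readAt n (fencePos n))) X (loRead n X) (bits n m (fencePos n)))
      (At M n τ (.inr .ret) (0 : ℕ) (loRet X 0) (bitsRet n m X 0)) := by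
  have hpos : 1 ≤ fencePos n := by
    have := fencePos_add_one n
    have h2 : 2 ^ 1 ≤ 2 ^ (n + 1) := Nat.pow_le_pow_right (by norm_num) (by omega)
    nlinarith
  have hmod := fencePos_mod n
  have h1 : (M.fence n).Leads (fun c => 0 ≤ c.head ∧ c.head ≤ (X + n : ℕ))
      (At M n τ (.inr (.readAt n (fencePos n))) X (loRead n X) (bits n m (fencePos n)))
      (At M n τ (.inr .ret) (X - 1 : ℕ) (loRet X (X - 1)) (bitsRet n m X (X - 1))) := by
    refine leads_put (v := 4) (b := true) (d := .left) (fun l _ => ?_) (by omega) (by omega)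
      (by simp; omega) ?_ (fun x => ?_) (fun x => ?_)
    · simp only [prepδ]
      have h : ¬ fencePos n % (n + 1) + 1 < n + 1 := by omega
      rw [if_neg (by rw [hblank _ (by omega)]; simp), dif_neg h, hX, bits_self, if_pos]
      exact (carry_and_digit_iff le_rfl h).2 rfl
    · simp only [loRead]
      split_ifs <;> omega
    · simp only [Function.update_apply, loRet, loRead]
      split_ifs <;> omega
    · simp only [Function.update_apply, bitsRet, show X - m = fencePos n by omega]
      split_ifs <;> first | rfl | omega
  refine h1.trans (Leads.iterate_down
    (F := fun p => At M n τ (.inr .ret) p (loRet X p) (bitsRet n m X p)) (X - 1) fun p hp => ?_)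
  refine leads_put (v := 1) (b := false) (d := .left) (fun l hl => ?_) (by omega) (by omega)
    (by simp) ?_ (fun x => ?_) (fun x => ?_)
  · simp only [prepδ]
    rw [if_neg]
    simp only [loRet] at hl
    split_ifs at hl <;> omega
  · simp only [loRet]
    split_ifs <;> omega
  · simp only [Function.update_apply, loRet]
    split_ifs <;> omega
  · simp only [Function.update_apply, bitsRet]
    split_ifs <;> first | rfl | omega

/-- The initial configuration of the fenced machine over the tape `τ`. -/
def fenceInit (M : DTM A) (n : ℕ) (τ : ℤ → M.Symbol) : (M.fence n).Cfg :=
  ⟨.inr .init, fun x => (τ x, Fin.last _, false), 0⟩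

/-- A tape of the fenced machine, with fence at `X`, over the tape `σ`. -/
structure Fenced {Γ : Type*} {n : ℕ} (X : ℕ) (σ : ℤ → Γ) (t : ℤ → Γ × Fin (2 * n + 8) × Bool) :
    Prop where
  content : ∀ x, (t x).1 = σ x
  bit : ∀ x < (X : ℤ), (t x).2.2 = false
  fence : (t X).2.2 = true
  layer : 0 < (t X).2.1.val

/-- A configuration of the fenced machine, with fence at `X`, that simulates a configuration of the
original machine. -/
structure Simulates (M : DTM A) (n X : ℕ) (c : M.Cfg) (c' : (M.fence n).Cfg) : Prop where
  state : c'.state = .inl c.state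
  head : c'.head = c.head
  tape : Fenced (n := n) X c.tape c'.tape

theorem exists_simulates_of_fenceInit {m X : ℕ} (hm : 1 ≤ m) (hX : X = m + fencePos n)
    (hin : ∀ x : ℤ, 0 < x → x < m → τ x ≠ M.blank) (hblank : ∀ x : ℤ, m ≤ x → τ x = M.blank) :
    ∃ c, Simulates M n X ⟨M.start, τ, 0⟩ c ∧ ReflTransGen (fun a b => (M.fence n).step a = some b ∧
      (0 ≤ a.head ∧ a.head ≤ (X + n : ℕ))) (fenceInit M n τ) c := by
  have hpos : 1 ≤ fencePos n := by
    have := fencePos_add_one n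
    have h2 : 2 ^ 1 ≤ 2 ^ (n + 1) := Nat.pow_le_pow_right (by norm_num) (by omega)
    nlinarith
  have h0 : Good M n τ (2 * n + 7) (fun x => 2 * n + 7) (fun _ => false) (fenceInit M n τ).tape :=
    ⟨fun _ => rfl, rfl, fun _ => le_rfl, fun _ => rfl⟩
  obtain ⟨c1, e1, e2, e3, e4⟩ := step_of_put (r := .init) (v := 2) (b := false)
    (r' := .inr (.read 0 true)) (d := .right) (lo' := loWalk n 1) (bit' := fun _ => false)
    rfl rfl h0 (fun l _ _ => rfl) (Or.inl (by omega)) (fun x => by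
      simp only [Function.update_apply, loWalk, fenceInit]
      split_ifs <;> omega) (fun x => by simp [Function.update_apply])
  have h1 : At M n τ (.inr (.read 0 true)) 1 (loWalk n 1) (fun _ => false) c1 := ⟨e2, e3, e4⟩
  have hdigits := Leads.iterate (M := M.fence n) (P := fun c => 0 ≤ c.head ∧ c.head ≤ (X + n : ℕ))
    (F := fun i => At M n τ (.inr (.readAt n i)) (m + i : ℕ) (loRead n (m + i)) (bits n m i))
    (Nat.zero_le (fencePos n)) fun i _ hi => leads_digit hm hi (by omega) hblank
  beta_reduce at hdigits
  rw [← hX] at hdigits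
  obtain ⟨c2, ⟨f1, f2, f3⟩, f4⟩ := ((leads_walk (X := X + n) hm (by omega) hin).trans
    (hdigits.trans (leads_ret hm hX hblank))) c1 h1
  -- From here on two layers matter: that of cell 1, for the extra step by which a head that must
  -- always move gets back to cell 0, and that of the fence, for the rejecting step.
  obtain ⟨c3, g1, g2, g3, g4⟩ := step_of_put (r := .ret) (v := 1) (b := false)
    (r' := .inr .bounce) (d := .right) (lo' := fun x => if x = 1 then 1 else if x = X then 4 else 0)
    (bit' := bitsRet n m X 0)
    f1 f2 f3 (fun l _ h => by simp only [prepδ]; rw [if_pos (by have := h rfl; omega)])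
    (Or.inr ⟨rfl, by omega⟩) (fun x => by
      simp only [Function.update_apply, loRet]
      split_ifs <;> omega) (fun x => by
      simp only [Function.update_apply, bitsRet, bits]
      split_ifs <;> first | rfl | omega)
  obtain ⟨c4, k1, k2, k3, k4⟩ := step_of_put (r := .bounce) (v := 0) (b := bitsRet n m X 0 1)
    (r' := .inl M.start) (d := .left) (lo' := fun x => if x = X then 4 else 0)
    (bit' := bitsRet n m X 0)
    g2 g3 g4 (fun l _ h => rfl) (Or.inl (by simp)) (fun x => by
      simp only [Function.update_apply]
      split_ifs <;> first | omega | (simp at *; omega)) (fun x => by simp)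
  refine ⟨c4, ⟨k2, by simpa using k3, k4.content, fun x hx => ?_, ?_, ?_⟩, ?_⟩
  · rw [k4.bit]
    simp only [bitsRet, bits]
    split_ifs <;> first | rfl | omega
  · rw [k4.bit]
    simp only [bitsRet]
    split_ifs <;> first | rfl | omega
  · have := k4.lo X
    rw [if_pos rfl] at this
    omega
  · refine ReflTransGen.head ⟨e1, le_rfl, by simp only [fenceInit]; omega⟩ (f4.trans ?_)
    refine ReflTransGen.head ⟨g1, by omega, by omega⟩ (.single ⟨k1, ?_⟩)
    simp only [g3, shift_right]
    omega

end Setup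

/-! ### The simulation -/

section Simulation

variable {M : DTM A} {n X : ℕ} {c : M.Cfg} {c' : (M.fence n).Cfg}

theorem Fenced.update {Γ : Type*} {n X : ℕ} {σ : ℤ → Γ} {t : ℤ → Γ × Fin (2 * n + 8) × Bool}
    (h : Fenced X σ t) {x : ℤ} (hx : x < X) (γ : Γ) :
    Fenced X (Function.update σ x γ) (Function.update t x (γ, 0, false)) := by
  refine ⟨fun y => ?_, fun y hy => ?_, ?_, ?_⟩
  · by_cases e : y = x
    · rw [e, Function.update_self, Function.update_self]
    · rw [Function.update_of_ne e, Function.update_of_ne e, h.content]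
  · by_cases e : y = x
    · rw [e, Function.update_self]
    · rw [Function.update_of_ne e, h.bit y hy]
  · rw [Function.update_of_ne hx.ne', h.fence]
  · rw [Function.update_of_ne hx.ne']
    exact h.layer

theorem fenceδ_of_fenced {q : M.State} {x : ℤ} {σ : ℤ → M.Symbol}
    {t : ℤ → M.Symbol × Fin (2 * n + 8) × Bool} (h : Fenced X σ t) (hX : x < X) :
    M.fenceδ n (.inl q) (t x) =
      (M.δ q (σ x)).map fun r => (.inl r.1, (r.2.1, 0, false), r.2.2) := by
  simp only [fenceδ]
  rw [if_neg (by rw [h.bit _ hX]; simp), h.content]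

theorem Simulates.δ_eq (h : Simulates M n X c c') (hX : c.head < X) :
    M.fenceδ n c'.state (c'.tape c'.head) =
      (M.δ c.state (c.tape c.head)).map fun r => (.inl r.1, (r.2.1, 0, false), r.2.2) := by
  rw [h.state, h.head]
  exact fenceδ_of_fenced h.tape hX

theorem Simulates.step_eq_none (h : Simulates M n X c c') (hX : c.head < X) :
    (M.fence n).step c' = none ↔ M.step c = none := by
  rw [DTM.step_eq_none, DTM.step_eq_none]
  change M.fenceδ n c'.state (c'.tape c'.head) = none ↔ _
  rw [h.δ_eq hX, Option.map_eq_none_iff]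

theorem Simulates.exists_step (h : Simulates M n X c c') (hX : c.head < X) {d : M.Cfg}
    (hd : M.step c = some d) : ∃ d', (M.fence n).step c' = some d' ∧ Simulates M n X d d' := by
  obtain ⟨q, τ, e, hδ, rfl⟩ := step_eq_some hd
  have h1 := h.δ_eq hX
  rw [hδ, Option.map_some] at h1
  refine ⟨_, step_of_δ h1, rfl, congrArg (· + shift e) h.head, ?_⟩
  have h2 := h.tape.update hX τ
  rw [← h.head] at h2 ⊢
  exact h2

theorem Simulates.step_fence (h : Simulates M n X c c') (hX : c.head = X) :
    ∃ d', (M.fence n).step c' = some d' ∧ d'.state = .inr .reject ∧ d'.head = X - 1 := by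
  obtain ⟨σ, h1⟩ : ∃ σ, M.fenceδ n (.inl c.state) (c'.tape X) =
      some (.inr .reject, σ, .left) := by
    simp only [fenceδ]
    rw [if_pos h.tape.fence]
    exact ⟨_, dif_pos h.tape.layer⟩
  rw [← hX, ← h.head, ← h.state] at h1
  exact ⟨_, step_of_δ h1, rfl, by rw [h.head, hX]; rfl⟩

theorem step_eq_none_of_reject (h : c'.state = .inr .reject) : (M.fence n).step c' = none := by
  rw [DTM.step_eq_none]
  change M.fenceδ n c'.state (c'.tape c'.head) = _
  rw [h]
  rfl

/-- Touching the fence sends the head left into a state without transitions, so it cannot pass,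
whatever `M` does. -/
theorem Simulates.of_reaches (h : Simulates M n X c c') (hX : c.head ≤ X) {d' : (M.fence n).Cfg}
    (hd : (M.fence n).Reaches c' d') :
    (∃ d, M.Reaches c d ∧ d.head ≤ X ∧ Simulates M n X d d') ∨
      (d'.state = .inr .reject ∧ d'.head = X - 1) := by
  induction hd with
  | refl => exact Or.inl ⟨c, .refl, hX, h⟩
  | @tail b' d' _ hs ih =>
    rw [Option.mem_def] at hs
    rcases ih with ⟨b, h1, h2, h3⟩ | ⟨h1, -⟩
    · rcases h2.lt_or_eq with h2 | h2
      · cases e : M.step b with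
        | none => rw [(h3.step_eq_none h2).2 e] at hs; cases hs
        | some d =>
          obtain ⟨d'', e1, e2⟩ := h3.exists_step h2 e
          obtain rfl := Option.some.inj (e1.symm.trans hs)
          have := head_of_step e
          exact Or.inl ⟨d, h1.tail e, by omega, e2⟩
      · obtain ⟨d'', e1, e2⟩ := h3.step_fence h2
        obtain rfl := Option.some.inj (e1.symm.trans hs)
        exact Or.inr e2
    · rw [step_eq_none_of_reject h1] at hs; cases hs

theorem Simulates.reaches (h : Simulates M n X c c') (hX : ∀ d, M.Reaches c d → d.head < X)
    {d : M.Cfg} (hd : M.Reaches c d) :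
    ∃ d', (M.fence n).Reaches c' d' ∧ Simulates M n X d d' := by
  induction hd with
  | refl => exact ⟨c', .refl, h⟩
  | tail hb hs ih =>
    obtain ⟨b', h1, h2⟩ := ih
    obtain ⟨d', e1, e2⟩ := h2.exists_step (hX _ hb) hs
    exact ⟨d', h1.tail e1, e2⟩

end Simulation

/-- A parameter for which the fence is beyond the reach of halting computations. -/
noncomputable def fenceParam (M : DTM A) : ℕ := Nat.card M.State * Nat.card M.Symbol

/-- Because |Q| + 1 ≤ 2^|Q|, the bound of `WeightReducing.head_le` is at most 2^n for n = |Q|·|Γ|.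
-/
theorem card_pow_lt_fencePos (M : DTM A) :
    (Nat.card M.State + 1) ^ Nat.card M.Symbol < fencePos M.fenceParam := by
  have hq : 0 < Nat.card M.State := Nat.card_pos_iff.2 ⟨⟨M.start⟩, inferInstance⟩
  have hg : 0 < Nat.card M.Symbol := Nat.card_pos_iff.2 ⟨⟨M.blank⟩, inferInstance⟩
  have hn : 0 < M.fenceParam := Nat.mul_pos hq hg
  have h1 : (Nat.card M.State + 1) ^ Nat.card M.Symbol ≤ 2 ^ M.fenceParam := by
    rw [fenceParam, pow_mul]
    exact Nat.pow_le_pow_left Nat.lt_two_pow_self _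
  have h2 := fencePos_add_one M.fenceParam
  have h3 : 2 ^ 1 ≤ 2 ^ M.fenceParam := Nat.pow_le_pow_right (by norm_num) hn
  rw [pow_succ] at h2
  nlinarith

section Spec

variable {M : DTM A} {τ : ℤ → M.Symbol} {m : ℕ}

/-- An accepting fenced run never touches the fence, so it copies a run of `M`. Conversely a halting
run of `M` stays short of the fence by `WeightReducing.head_le`, so rejecting there loses nothing.
-/
theorem acceptsFrom_fenceInit (hM : M.WeightReducing) (hm : 1 ≤ m)
    (hin : ∀ x : ℤ, 0 < x → x < m → τ x ≠ M.blank) (hblank : ∀ x : ℤ, m ≤ x → τ x = M.blank) :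
    (M.fence M.fenceParam).AcceptsFrom (fenceInit M M.fenceParam τ) ↔
      M.AcceptsFrom ⟨M.start, τ, 0⟩ := by
  obtain ⟨c', hc, hp⟩ := exists_simulates_of_fenceInit (n := M.fenceParam) hm rfl hin hblank
  rw [acceptsFrom_congr (reaches_of_path hp)]
  constructor
  · rintro ⟨d', hd, hfin⟩
    obtain ⟨h1, h2⟩ := StateTransition.mem_eval.1 hd
    obtain ⟨q, hq, e⟩ := hfin
    rcases hc.of_reaches (by positivity) h1 with ⟨d, e1, e2, e3⟩ | ⟨e1, -⟩
    · rcases e2.lt_or_eq with e2 | e2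
      · refine ⟨d, StateTransition.mem_eval.2 ⟨e1, (e3.step_eq_none e2).1 h2⟩, ?_⟩
        rw [e3.state] at e
        exact Sum.inl_injective e ▸ hq
      · obtain ⟨_, h, _⟩ := e3.step_fence e2
        rw [h2] at h; cases h
    · rw [e1] at e; cases e
  · rintro ⟨d, hd, hfin⟩
    have hlt := M.card_pow_lt_fencePos
    have hX : ∀ e, M.Reaches ⟨M.start, τ, 0⟩ e → e.head < (m + fencePos M.fenceParam : ℕ) := by
      intro e he
      have := hM.head_le (m := m) hd (by simp only; omega) hblank he
      omega
    obtain ⟨h1, h2⟩ := StateTransition.mem_eval.1 hd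
    obtain ⟨d', e1, e2⟩ := hc.reaches hX h1
    exact ⟨d', StateTransition.mem_eval.2 ⟨e1, (e2.step_eq_none (hX _ h1)).2 h2⟩,
      d.state, hfin, e2.state.symm⟩

/-- The set-up stays on cells ≥ 0, and afterwards the head goes only where that of `M` goes. Thus
the bound given by the first fence survives the building of the second on the other side. -/
theorem head_le_of_fenceInit {n : ℕ} (hm : 1 ≤ m)
    (hin : ∀ x : ℤ, 0 < x → x < m → τ x ≠ M.blank) (hblank : ∀ x : ℤ, m ≤ x → τ x = M.blank)
    {d' : (M.fence n).Cfg} (hd : (M.fence n).Reaches (fenceInit M n τ) d') :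
    d'.head ≤ (m + fencePos n + n : ℕ) ∧
      ∀ Y : ℕ, (∀ d, M.Reaches ⟨M.start, τ, 0⟩ d → -(Y : ℤ) ≤ d.head) → -(Y : ℤ) ≤ d'.head := by
  obtain ⟨c', hc, hp⟩ := exists_simulates_of_fenceInit (n := n) hm rfl hin hblank
  rcases of_path_of_reaches hp hd with h | h
  · exact ⟨h.2, fun Y _ => by have := h.1; omega⟩
  · rcases hc.of_reaches (by positivity) h with ⟨d, e1, e2, e3⟩ | ⟨-, e1⟩
    · rw [e3.head]
      exact ⟨by omega, fun Y hY => hY d e1⟩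
    · exact ⟨by omega, fun Y _ => by omega⟩

end Spec

/-! ### The right fence, the left fence and the resulting head bounds. -/

theorem init_fence (M : DTM A) (n : ℕ) (w : List A) :
    (M.fence n).init w = fenceInit M n (M.init w).tape := by
  refine Cfg.ext rfl (fun x => ?_) rfl
  simp only [init, fenceInit]
  split_ifs with h
  · cases w[x.toNat]? <;> rfl
  · rfl

theorem init_tape_ne_blank (M : DTM A) (w : List A) {x : ℤ} (h0 : 0 ≤ x) (hx : x < w.length) :
    (M.init w).tape x ≠ M.blank := by
  simp only [init]
  rw [if_pos h0, List.getElem?_eq_getElem (by omega)]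
  exact M.blank_not_input _

theorem init_tape_eq_blank (M : DTM A) (w : List A) {x : ℤ} (h : x < 0 ∨ w.length ≤ x) :
    (M.init w).tape x = M.blank := by
  simp only [init]
  split_ifs with h0
  · rw [List.getElem?_eq_none (by omega)]; rfl
  · rfl

/-- The machine with a fence to the right of the input. -/
noncomputable def rightFence (M : DTM A) : DTM A := M.fence M.fenceParam

/-- The machine with a fence to the left of the input. -/
noncomputable def leftFence (M : DTM A) : DTM A := M.mirror.rightFence.mirror

theorem WeightReducing.rightFence {M : DTM A} (h : M.WeightReducing) :
    M.rightFence.WeightReducing := h.fence _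

theorem WeightReducing.leftFence {M : DTM A} (h : M.WeightReducing) :
    M.leftFence.WeightReducing := h.mirror.rightFence.mirror

theorem language_rightFence {M : DTM A} (h : M.WeightReducing) :
    M.rightFence.language = M.language := by
  ext w
  rw [mem_language_iff, mem_language_iff, rightFence, init_fence]
  -- The start cell counts as part of the input even for the empty word, hence the maximum.
  exact acceptsFrom_fenceInit h (le_max_left 1 w.length)
    (fun x h0 hx => init_tape_ne_blank M w h0.le (by omega))
    (fun x hx => init_tape_eq_blank M w (Or.inr (by omega)))

theorem head_le_of_rightFence (M : DTM A) :
    ∃ N : ℕ, ∀ w d, M.rightFence.Reaches (M.rightFence.init w) d → d.head ≤ (w.length + N : ℕ) := by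
  refine ⟨1 + fencePos M.fenceParam + M.fenceParam, fun w d hd => ?_⟩
  change (M.fence M.fenceParam).Reaches ((M.fence M.fenceParam).init w) d at hd
  rw [init_fence] at hd
  have := (head_le_of_fenceInit (le_max_left 1 w.length)
    (fun x h0 hx => init_tape_ne_blank M w h0.le (by omega))
    (fun x hx => init_tape_eq_blank M w (Or.inr (by omega))) hd).1
  omega

theorem init_leftFence (M : DTM A) (w : List A) :
    M.leftFence.init w =
      Cfg.mirror (fenceInit M.mirror M.mirror.fenceParam (M.init w).mirror.tape) := by
  refine Cfg.ext rfl (fun x => ?_) rfl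
  simp only [init, fenceInit, Cfg.mirror, neg_neg]
  split_ifs with h
  · cases w[x.toNat]? <;> rfl
  · rfl

/-- In the mirror image the input lies on cells ≤ 0, so no input has to be crossed and the blocks
start at cell 1. -/
theorem init_mirror_tape (M : DTM A) (w : List A) (x : ℤ) (hx : (1 : ℕ) ≤ x) :
    (M.init w).mirror.tape x = M.mirror.blank :=
  init_tape_eq_blank M w (Or.inl (by omega))

theorem language_leftFence {M : DTM A} (h : M.WeightReducing) :
    M.leftFence.language = M.language := by
  ext w
  rw [mem_language_iff, mem_language_iff, init_leftFence, ← acceptsFrom_mirror (M := M)]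
  refine acceptsFrom_mirror.trans
    (acceptsFrom_fenceInit h.mirror le_rfl (fun x h0 hx => by omega) (init_mirror_tape M w))

theorem head_bounds_of_leftFence {M : DTM A} {N : ℕ}
    (hN : ∀ w d, M.Reaches (M.init w) d → d.head ≤ (w.length + N : ℕ)) :
    ∃ N : ℕ, ∀ w d, M.leftFence.Reaches (M.leftFence.init w) d →
      -(N : ℤ) ≤ d.head ∧ d.head ≤ w.length + N := by
  refine ⟨N + (1 + fencePos M.mirror.fenceParam + M.mirror.fenceParam), fun w d hd => ?_⟩
  rw [init_leftFence] at hd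
  obtain ⟨d, rfl, hd'⟩ := exists_reaches_of_mirror (M := M.mirror.rightFence) hd
  obtain ⟨h1, h2⟩ := head_le_of_fenceInit (M := M.mirror) le_rfl (fun x h0 hx => by omega)
    (init_mirror_tape M w) hd'
  -- A left bound for the mirrored machine is the reflected right bound for `M`.
  have h3 := h2 (w.length + N) fun e he => by
    obtain ⟨e, rfl, he'⟩ := exists_reaches_of_mirror (c := M.init w) he
    have := hN w e he'
    simp only [Cfg.mirror]
    omega
  simp only [Cfg.mirror]
  omega

/-! ### Sizes -/

section Size

theorem length_binary (k m : ℕ) : (binary k m).length = k := by simp [binary]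

theorem length_unary (k : ℕ) : (unary k).length = k + 1 := by simp [unary]

theorem length_entryCode (M : DTM A) (p : M.State) (σ : M.Symbol) :
    (M.entryCode p σ).length = Nat.clog 2 (Nat.card M.State) + Nat.clog 2 (Nat.card M.Symbol) + 2 := by
  unfold entryCode
  split <;> simp [stateCode, symbolCode, length_binary, add_assoc]

theorem size_eq [Finite A] (M : DTM A) :
    M.size = Nat.card M.State + 1 + (Nat.card M.Symbol + 1) + (Nat.card A + 1) +
      Nat.card A * Nat.clog 2 (Nat.card M.Symbol) + Nat.clog 2 (Nat.card M.Symbol) +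
      Nat.clog 2 (Nat.card M.State) + Nat.card M.State +
      Nat.card M.State * (Nat.card M.Symbol *
        (Nat.clog 2 (Nat.card M.State) + Nat.clog 2 (Nat.card M.Symbol) + 2)) := by
  simp [size, description, List.length_flatMap, length_entryCode, length_unary, stateCode,
    symbolCode, length_binary, Function.comp_def]
  ring

/-- The total number of states, working symbols and input symbols. -/
noncomputable def total (M : DTM A) : ℕ := Nat.card M.State + Nat.card M.Symbol + Nat.card A

theorem one_le_total (M : DTM A) : 1 ≤ M.total := by
  have hq : 0 < Nat.card M.State := Nat.card_pos_iff.2 ⟨⟨M.start⟩, inferInstance⟩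
  unfold total; omega

theorem total_le_size [Finite A] (M : DTM A) : M.total ≤ M.size := by
  rw [size_eq, total]
  omega

/-- Together with `total_le_size`, which rests on the unary numbers in the description, this lets
`total` stand for the size up to a polynomial. -/
theorem size_le [Finite A] (M : DTM A) : M.size ≤ 20 * M.total ^ 3 := by
  have h1 := M.one_le_total
  have hc : ∀ k, Nat.clog 2 k ≤ k := fun k => Nat.clog_le_of_le_pow Nat.lt_two_pow_self.le
  have hq : Nat.card M.State ≤ M.total := by unfold total; omega
  have hg : Nat.card M.Symbol ≤ M.total := by unfold total; omega
  have ha : Nat.card A ≤ M.total := by unfold total; omega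
  have hcq := (hc _).trans hq
  have hcg := (hc _).trans hg
  rw [size_eq]
  generalize M.total = s at *
  calc _ ≤ s + 1 + (s + 1) + (s + 1) + s * s + s + s + s + s * (s * (s + s + 2)) := by gcongr
    _ ≤ 20 * s ^ 3 := by
      have h2 : s ≤ s ^ 3 := Nat.le_self_pow (by norm_num) s
      have h3 : s ^ 2 ≤ s ^ 3 := Nat.pow_le_pow_right h1 (by norm_num)
      nlinarith

theorem total_mirror (M : DTM A) : M.mirror.total = M.total := rfl

/-- The set-up states are quadratic and the layers linear in `fenceParam`, itself at most the square
of `total`. The constant is 112 for the set-up states, 20 for the symbols and 1 for the rest. -/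
theorem total_rightFence_le (M : DTM A) : M.rightFence.total ≤ 133 * M.total ^ 4 := by
  have h1 := M.one_le_total
  have hn : M.fenceParam ≤ M.total ^ 2 := by
    rw [fenceParam, sq]
    refine Nat.mul_le_mul ?_ ?_ <;> (unfold total; omega)
  have hg : Nat.card M.Symbol ≤ M.total := by unfold total; omega
  have e1 : Nat.card M.rightFence.State = Nat.card M.State + Nat.card (Prep M.fenceParam) :=
    Nat.card_sum
  have e2 : Nat.card M.rightFence.Symbol = Nat.card M.Symbol * ((2 * M.fenceParam + 8) * 2) := by
    change Nat.card (M.Symbol × Fin (2 * M.fenceParam + 8) × Bool) = _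
    rw [Nat.card_prod, Nat.card_prod, Nat.card_eq_fintype_card (α := Fin _), Fintype.card_fin,
      Nat.card_eq_fintype_card (α := Bool), Fintype.card_bool]
  have e3 := Prep.card_le M.fenceParam
  have h2 : M.total ≤ M.total ^ 4 := Nat.le_self_pow (by norm_num) _
  have h3 : M.total ^ 3 ≤ M.total ^ 4 := Nat.pow_le_pow_right h1 (by norm_num)
  have h4 : M.total ^ 2 ≤ M.total ^ 4 := Nat.pow_le_pow_right h1 (by norm_num)
  have h5 : 1 ≤ M.total ^ 4 := Nat.one_le_pow _ _ h1
  have h6 : 28 * (M.fenceParam + 1) ^ 2 ≤ 112 * M.total ^ 4 := by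
    calc 28 * (M.fenceParam + 1) ^ 2 ≤ 28 * (M.total ^ 2 + 1) ^ 2 := by gcongr
      _ ≤ 112 * M.total ^ 4 := by nlinarith
  have h7 : Nat.card M.Symbol * ((2 * M.fenceParam + 8) * 2) ≤ 20 * M.total ^ 4 := by
    calc _ ≤ M.total * ((2 * M.total ^ 2 + 8) * 2) := by gcongr
      _ ≤ 20 * M.total ^ 4 := by nlinarith
  have h8 : M.rightFence.total = Nat.card M.State + Nat.card (Prep M.fenceParam) +
      Nat.card M.Symbol * ((2 * M.fenceParam + 8) * 2) + Nat.card A := by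
    rw [← e1, ← e2]; rfl
  have h9 : M.total = Nat.card M.State + Nat.card M.Symbol + Nat.card A := rfl
  omega

theorem total_leftFence_le (M : DTM A) : M.leftFence.total ≤ 133 * M.total ^ 4 := by
  rw [leftFence, total_mirror, ← total_mirror M]
  exact total_rightFence_le _

end Size

end DTM

theorem mainTheorem3 :
    ∃ P : Polynomial ℕ, ∀ (A : Type u) [Finite A] (M : DTM A), M.WeightReducing →
      ∃ M' : DTM A, M'.WeightReducing ∧ M'.LinearTime ∧ M'.language = M.language ∧
        M'.size ≤ P.eval M.size := by
  -- The bound of `total_rightFence_le` applied once for each fence, inside that of `size_le`.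
  refine ⟨.C 20 * (.C 133 * (.C 133 * .X ^ 4) ^ 4) ^ 3, fun A _ M hM =>
    ⟨M.rightFence.leftFence, hM.rightFence.leftFence, ?_, ?_, ?_⟩⟩
  · obtain ⟨N, hN⟩ := M.head_le_of_rightFence
    obtain ⟨N', hN'⟩ := DTM.head_bounds_of_leftFence hN
    exact hM.rightFence.leftFence.linearTime N' hN'
  · rw [DTM.language_leftFence hM.rightFence, DTM.language_rightFence hM]
  · simp only [Polynomial.eval_mul, Polynomial.eval_pow, Polynomial.eval_C, Polynomial.eval_X]
    calc _ ≤ 20 * M.rightFence.leftFence.total ^ 3 := DTM.size_le _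
      _ ≤ 20 * (133 * M.rightFence.total ^ 4) ^ 3 := by
        gcongr; exact DTM.total_leftFence_le _
      _ ≤ 20 * (133 * (133 * M.total ^ 4) ^ 4) ^ 3 := by
        gcongr; exact DTM.total_rightFence_le _
      _ ≤ _ := by gcongr; exact M.total_le_size
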